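/- **Setting.** Let $\Omega\subset\mathbb C^m$ be a domain and $\Psi$ a class of holomorphic test functions on $\Omega$: a set of holomorphic functions $\psi:\Omega\to\mathbb C$ such that $\sup_{\psi\in\Psi}|\psi(x)|<1$ for every $x\in\Omega$, and such that for every finite $F\subset\Omega$ the restrictions $\psi|_F$ together with the constants generate the algebra of all functions $F\to\mathbb C$. Give $\Psi$ the topology of pointwise convergence, let $\mathcal C_b(\Psi)$ be the $C^*$-algebra of bounded continuous functions on $\Psi$, and let $E(x)\in\mathcal C_b(\Psi)$, $E(x)(\psi)=\psi(x)$. Let $\mathscr U,\mathscr Y$ be complex Hilbert spaces. For a Hilbert space $\mathcal E$, a function $k:\Omega\times\Omega\to B(\mathcal E)$ is a positive kernel if $\sum_{i,j}\langle k(x_i,x_j)e_j,e_i\rangle\ge0$ for all finite families $x_i\in\Omega$, $e_i\in\mathcal E$; it is $\Psi$-admissible if moreover, for each $\psi\in\Psi$, multiplication by $\psi$ is a contraction on the reproducing kernel Hilbert space $\mathcal H(k)$. The $\Psi$-Schur–Agler class $\mathcal{SA}_\Psi(\mathscr U,\mathscr Y)$ consists of all $S:\Omega\to B(\mathscr U,\mathscr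 Y)$ such that $(I_{\mathscr Y}-S(x)S(y)^*)\otimes k(x,y)$ is a positive $B(\mathscr Y\otimes\mathscr Y)$-valued kernel for every $\Psi$-admissible $B(\mathscr Y)$-valued kernel $k$. For a set $N$, a map $\Gamma:N\times N\to B(\mathcal C_b(\Psi),B(\mathscr Y))$ is a completely positive kernel if $\sum_{i,j}b_i^*\,\Gamma(p_i,p_j)(a_i^*a_j)\,b_j\ge0$ for all finite families $p_i\in N$, $a_i\in\mathcal C_b(\Psi)$, $b_i\in B(\mathscr Y)$. Let $z_1,\dots,z_n\in\Omega$, $B_1,\dots,B_n\in B(\mathscr U,\mathscr Y)$, and let $\Gamma$ be a completely positive kernel on $\{z_1,\dots,z_n\}$ with $I-B_iB_j^*=\Gamma(z_i,z_j)(1-E(z_i)E(z_j)^*)$ for all $i,j$. Suppose that $f\in\mathcal{SA}_\Psi(\mathscr U,\mathscr Y)$ satisfies $f(z_i)=B_i$ for all $i$ and is affiliated with $\Gamma$: there is a completely positive kernel $\Delta$ on $\Omega$ with $I-f(x)f(y)^*=\Delta(x,y)(1-E(x)E(y)^*)$ for all $x,y\in\Omega$ and $\Delta(z_i,z_j)=\Gamma(z_i,z_j)$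 for all $i,j$. **The auxiliary function.** Let $(\mathscr X_1,\mu,h)$ be a Kolmogorov decomposition of $\Gamma$: a Hilbert space $\mathscr X_1$, a unital $*$-representation $\mu:\mathcal C_b(\Psi)\to B(\mathscr X_1)$ and operators $h(z_i)\in B(\mathscr X_1,\mathscr Y)$ with $\Gamma(z_i,z_j)(\delta)=h(z_i)\mu(\delta)h(z_j)^*$. Put $\mathscr L_1=\overline{\operatorname{span}}\{\mu(\delta)h(z_i)^*y\}$ and regard $\mu(\delta)$ as an operator on $\mathscr L_1$ by restriction. Put $$\mathscr N_2=\overline{\operatorname{span}}\{\mu(E(z_i))^*h(z_i)^*y\oplus y\}\subset\mathscr L_1\oplus\mathscr Y,\qquad \mathscr N_1=\overline{\operatorname{span}}\{h(z_i)^*y\oplus B_i^*y\}\subset\mathscr L_1\oplus\mathscr U,$$ $\mathscr M_2=(\mathscr L_1\oplus\mathscr Y)\ominus\mathscr N_2$, $\mathscr M_1=(\mathscr L_1\oplus\mathscr U)\ominus\mathscr N_1$ (here $1\le i\le n$, $y\in\mathscr Y$, $\delta\in\mathcal C_b(\Psi)$). Let $V:\mathscr N_2\to\mathscr N_1$ be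 the unitary sending $\mu(E(z_i))^*h(z_i)^*y\oplus y$ to $h(z_i)^*y\oplus B_i^*y$, let $\mathcal Q:n_2\oplus m_2\oplus m_1\mapsto Vn_2\oplus m_1\oplus m_2$, written as a block operator $(\mathcal Q_{ij})$ from $\mathscr L_1\oplus(\mathscr M_1\oplus\mathscr Y)$ to $\mathscr L_1\oplus(\mathscr M_2\oplus\mathscr U)$, and let $$G(x)=\mathcal Q_{22}^*+\mathcal Q_{12}^*\bigl(I-\mu(E(x))\mathcal Q_{11}^*\bigr)^{-1}\mu(E(x))\mathcal Q_{21}^*=\begin{pmatrix}G_{11}(x)&G_{12}(x)\\G_{21}(x)&G_{22}(x)\end{pmatrix}:\mathscr M_2\oplus\mathscr U\to\mathscr M_1\oplus\mathscr Y .$$ **Theorem.** $\Gamma$ has a Kolmogorov decomposition, and for every Kolmogorov decomposition of $\Gamma$ the function $G$ built from it satisfies $G\in\mathcal{SA}_\Psi(\mathscr M_2\oplus\mathscr U,\mathscr M_1\oplus\mathscr Y)$ and $\|G_{11}(x)\|<1$ for all $x\in\Omega$, and there is $\mathbf t\in\mathcal{SA}_\Psi(\mathscr M_1,\mathscr M_2)$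 such that, for all $x\in\Omega$, the operator $I_{\mathscr M_2}-\mathbf t(x)G_{11}(x)$ is invertible and $$f(x)=G_{22}(x)+G_{21}(x)\bigl(I_{\mathscr M_2}-\mathbf t(x)G_{11}(x)\bigr)^{-1}\mathbf t(x)\,G_{12}(x).$$ -/

import Mathlib

open scoped ComplexOrder InnerProduct TensorProduct BoundedContinuousFunction

noncomputable section

namespace SchurAgler

/-! ### Test functions -/

/-- A collection of test functions on a set `X`. -/
structure TestFunctions (X : Type*) where
  /-- the underlying collection of functions -/
  carrier : Set (X → ℂ)
  /-- for every point `x`, the supremum of `|ψ x|` over the collection is less than one -/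
  sup_lt_one : ∀ x : X, ∃ r : ℝ, r < 1 ∧ ∀ ψ ∈ carrier, ‖ψ x‖ ≤ r
  /-- on each finite set, the restrictions together with the constants generate the algebra of all
  functions -/
  generates : ∀ F : Finset X,
    Algebra.adjoin ℂ ((fun (ψ : X → ℂ) (x : F) => ψ x) '' carrier) = ⊤

/-- The algebra of bounded continuous functions on the collection, which carries the topology of
pointwise convergence (the subspace topology of the product topology). -/
abbrev TestFunctions.Cb {X : Type*} (Ψ : TestFunctions X) : Type _ := Ψ.carrier →ᵇ ℂ

/-- The evaluation `E(x) : ψ ↦ ψ(x)`. -/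
def TestFunctions.E {X : Type*} (Ψ : TestFunctions X) (x : X) : Ψ.Cb :=
  BoundedContinuousFunction.ofNormedAddCommGroup (fun ψ : Ψ.carrier => (ψ : X → ℂ) x)
    ((continuous_apply x).comp continuous_subtype_val) 1 (by
      intro ψ
      obtain ⟨r, hr, h⟩ := Ψ.sup_lt_one x
      exact (h _ ψ.2).trans hr.le)

/-- All test functions are holomorphic on the set `Ω` in a complex normed space. -/
def TestFunctions.IsHolomorphic {V : Type*} [NormedAddCommGroup V] [NormedSpace ℂ V] {Ω : Set V}
    (Ψ : TestFunctions Ω) : Prop :=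
  ∀ ψ ∈ Ψ.carrier, ∃ g : V → ℂ, DifferentiableOn ℂ g Ω ∧ ∀ x : Ω, g x = ψ x

/-! ### Positive and completely positive kernels -/

/-- Positive operator valued kernels. -/
def IsPositiveKernel {X H : Type*} [NormedAddCommGroup H] [InnerProductSpace ℂ H]
    (k : X → X → (H →L[ℂ] H)) : Prop :=
  ∀ (n : ℕ) (x : Fin n → X) (e : Fin n → H),
    0 ≤ ∑ i, ∑ j, inner ℂ (e i) (k (x i) (x j) (e j))

/-- Completely positive kernels with values in the bounded operators from `C_b(Ψ)` to `B(H)`. -/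
def IsCompletelyPositive {X N H : Type*} [NormedAddCommGroup H] [InnerProductSpace ℂ H]
    [CompleteSpace H] {Ψ : TestFunctions X} (Γ : N → N → (Ψ.Cb →L[ℂ] (H →L[ℂ] H))) : Prop :=
  ∀ (n : ℕ) (x : Fin n → N) (a : Fin n → Ψ.Cb) (b : Fin n → (H →L[ℂ] H)),
    (∑ i, ∑ j, star (b i) * Γ (x i) (x j) (star (a i) * a j) * b j).IsPositive

/-- A positive operator valued kernel is a positive semidefinite matrix. -/
theorem IsPositiveKernel.posSemidef {X H : Type*} [NormedAddCommGroup H] [InnerProductSpace ℂ H]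
    [CompleteSpace H] {k : X → X → (H →L[ℂ] H)} (hk : IsPositiveKernel k) :
    (Matrix.of k).PosSemidef := by
  have hs : ∀ x : X →₀ H, 0 ≤ x.sum fun p a => x.sum fun q b => inner ℂ a (k p q b) := by
    intro x
    have e := x.support.equivFin
    have := hk _ (fun i => (e.symm i : X)) (fun i => x (e.symm i))
    convert this using 1
    simp only [Finsupp.sum]
    rw [← Finset.sum_coe_sort, ← e.symm.sum_comp]
    refine Finset.sum_congr rfl fun i _ => ?_
    rw [← Finset.sum_coe_sort, ← e.symm.sum_comp]
  have hself : ∀ p (a : H), 0 ≤ inner ℂ a (k p p a) := by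
    intro p a
    simpa using hk 1 (fun _ => p) (fun _ => a)
  have hherm : ∀ p q, (k p q)† = k q p := by
    intro p q
    refine ContinuousLinearMap.ext fun a => ext_inner_left ℂ fun b => ?_
    rw [ContinuousLinearMap.adjoint_inner_right]
    have key : ∀ (a b : H), 0 ≤ inner ℂ a (k p q b) + inner ℂ b (k q p a)
        + (inner ℂ a (k p p a) + inner ℂ b (k q q b)) := by
      intro a b
      have := hk 2 ![p, q] ![a, b]
      simp [Fin.sum_univ_two] at this
      convert this using 1
      ring
    have im : ∀ (a b : H), (inner ℂ a (k p q b) + inner ℂ b (k q p a)).im = 0 := by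
      intro a b
      have h1 := (Complex.le_def.1 (key a b)).2
      have h2 := (Complex.le_def.1 (hself p a)).2
      have h3 := (Complex.le_def.1 (hself q b)).2
      simp only [Complex.add_im, Complex.zero_im] at h1 h2 h3 ⊢
      linarith
    have i1 := im a b
    have i2 := im a (Complex.I • b)
    simp only [map_smul, inner_smul_left, inner_smul_right, Complex.add_im, Complex.mul_im,
      Complex.conj_I, Complex.I_re, Complex.I_im, Complex.neg_re, Complex.neg_im] at i1 i2
    rw [← inner_conj_symm (k p q b) a]
    refine Complex.ext ?_ ?_
    · simp only [Complex.conj_re]; linarith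
    · simp only [Complex.conj_im]; linarith
  refine ((RKHS.posSemidef_tfae (K := Matrix.of k)).out 0 2 rfl rfl).2 ⟨?_, fun x => ?_⟩
  · ext1 p q
    exact hherm q p
  · have h1 := hs x
    rw [Finsupp.sum_comm] at h1
    have h2 := (RCLike.le_iff_re_im.1 h1).1
    have h3 : ∀ p q (a b : H), (inner ℂ (k p q b) a : ℂ).re = (inner ℂ a (k p q b)).re :=
      fun p q a b => by rw [← inner_conj_symm, Complex.conj_re]
    simp only [Finsupp.sum, Complex.re_sum, RCLike.re_to_complex, Matrix.of_apply, map_zero, h3]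
      at h2 ⊢
    exact h2

/-! ### Admissible kernels and the Schur-Agler class -/

/-- A positive kernel is admissible if multiplication by each test function is a contraction on the
reproducing kernel Hilbert space `H(K)`. -/
def IsAdmissible {X H : Type*} [NormedAddCommGroup H] [InnerProductSpace ℂ H] [CompleteSpace H]
    (Ψ : TestFunctions X) (K : X → X → (H →L[ℂ] H)) : Prop :=
  ∃ hK : IsPositiveKernel K,
    haveI : Fact (Matrix.of K).PosSemidef := ⟨hK.posSemidef⟩
    ∀ ψ ∈ Ψ.carrier, ∃ M : RKHS.OfKernel (Matrix.of K) →L[ℂ] RKHS.OfKernel (Matrix.of K),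
      ‖M‖ ≤ 1 ∧ ∀ (g : RKHS.OfKernel (Matrix.of K)) (x : X), M g x = ψ x • g x

/-- The Hilbert space tensor product. -/
abbrev HilbertTensor (H K : Type*) [NormedAddCommGroup H] [InnerProductSpace ℂ H]
    [NormedAddCommGroup K] [InnerProductSpace ℂ K] : Type _ :=
  UniformSpace.Completion (H ⊗[ℂ] K)

/-- The tensor product `S ⊗ T` of bounded operators, acting on the Hilbert space tensor product. -/
def tensorOp {H K : Type*} [NormedAddCommGroup H] [InnerProductSpace ℂ H]
    [NormedAddCommGroup K] [InnerProductSpace ℂ K] (S : H →L[ℂ] H) (T : K →L[ℂ] K) :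
    HilbertTensor H K →L[ℂ] HilbertTensor H K :=
  (UniformSpace.Completion.toComplL ∘L TensorProduct.mapL S T).extend
    (UniformSpace.Completion.toComplL : (H ⊗[ℂ] K) →L[ℂ] HilbertTensor H K)

/-- The `Ψ`-Schur-Agler class of `B(U, Y)`-valued functions. -/
def SchurAglerClass {X : Type*} (Ψ : TestFunctions X) (U Y : Type*)
    [NormedAddCommGroup U] [InnerProductSpace ℂ U] [CompleteSpace U]
    [NormedAddCommGroup Y] [InnerProductSpace ℂ Y] [CompleteSpace Y] : Set (X → (U →L[ℂ] Y)) :=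
  {S | ∀ k : X → X → (Y →L[ℂ] Y), IsAdmissible Ψ k →
    IsPositiveKernel fun x y => tensorOp (1 - S x ∘L (S y)†) (k x y)}

/-! ### Orthogonal sums -/

section Sums

variable {H A B : Type*} [NormedAddCommGroup H] [InnerProductSpace ℂ H]
  [NormedAddCommGroup A] [InnerProductSpace ℂ A] [NormedAddCommGroup B] [InnerProductSpace ℂ B]

/-- The orthogonal sum `A ⊕ B` of Hilbert spaces. -/
abbrev HSum (A B : Type*) : Type _ := WithLp 2 (A × B)

/-- The operator `x ↦ f x ⊕ g x`. -/
def pairL (f : H →L[ℂ] A) (g : H →L[ℂ] B) : H →L[ℂ] HSum A B :=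
  (WithLp.prodContinuousLinearEquiv 2 ℂ A B).symm.toContinuousLinearMap ∘L f.prod g

/-- The inclusion of the first summand. -/
def inlL : A →L[ℂ] HSum A B := pairL (ContinuousLinearMap.id ℂ A) 0

/-- The inclusion of the second summand. -/
def inrL : B →L[ℂ] HSum A B := pairL 0 (ContinuousLinearMap.id ℂ B)

/-- The projection to the first summand. -/
def fstL : HSum A B →L[ℂ] A := WithLp.fstL 2 ℂ A B

/-- The projection to the second summand. -/
def sndL : HSum A B →L[ℂ] B := WithLp.sndL 2 ℂ A B

variable {C D : Type*} [NormedAddCommGroup C] [InnerProductSpace ℂ C]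
  [NormedAddCommGroup D] [InnerProductSpace ℂ D]

/-- The entry `A → C` of the operator matrix of `T : A ⊕ B → C ⊕ D`. -/
def block11 (T : HSum A B →L[ℂ] HSum C D) : A →L[ℂ] C := fstL ∘L T ∘L inlL

/-- The entry `B → C` of the operator matrix of `T : A ⊕ B → C ⊕ D`. -/
def block12 (T : HSum A B →L[ℂ] HSum C D) : B →L[ℂ] C := fstL ∘L T ∘L inrL

/-- The entry `A → D` of the operator matrix of `T : A ⊕ B → C ⊕ D`. -/
def block21 (T : HSum A B →L[ℂ] HSum C D) : A →L[ℂ] D := sndL ∘L T ∘L inlL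

/-- The entry `B → D` of the operator matrix of `T : A ⊕ B → C ⊕ D`. -/
def block22 (T : HSum A B →L[ℂ] HSum C D) : B →L[ℂ] D := sndL ∘L T ∘L inrL

end Sums

/-! ### The unitary between the closed spans of two families with the same Gram matrix -/

section Gram

variable {ι H K : Type*} [NormedAddCommGroup H] [InnerProductSpace ℂ H]
  [NormedAddCommGroup K] [InnerProductSpace ℂ K]

/-- The closed linear span of a family of vectors. -/
def closedSpan (a : ι → H) : Submodule ℂ H :=
  (Submodule.span ℂ (Set.range a)).topologicalClosure

instance [CompleteSpace H] (a : ι → H) : CompleteSpace (closedSpan a) :=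
  (Submodule.isClosed_topologicalClosure _).completeSpace_coe

theorem mem_closedSpan (a : ι → H) (i : ι) : a i ∈ closedSpan a :=
  Submodule.le_topologicalClosure _ (Submodule.subset_span ⟨i, rfl⟩)

theorem linearCombination_mem_closedSpan (a : ι → H) (c : ι →₀ ℂ) :
    Finsupp.linearCombination ℂ a c ∈ closedSpan a :=
  Submodule.le_topologicalClosure _ (by
    rw [← Finsupp.range_linearCombination]; exact LinearMap.mem_range_self _ c)

/-- Finite linear combinations, as elements of the closed span. -/
def combination (a : ι → H) : (ι →₀ ℂ) →ₗ[ℂ] closedSpan a :=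
  (Finsupp.linearCombination ℂ a).codRestrict _ (linearCombination_mem_closedSpan a)

theorem denseRange_combination (a : ι → H) : DenseRange (combination a) := by
  rw [DenseRange, dense_iff_closure_eq, Set.eq_univ_iff_forall]
  rintro ⟨x, hx⟩
  rw [closure_subtype]
  have : Subtype.val '' Set.range (combination a) = (Submodule.span ℂ (Set.range a) : Set H) := by
    rw [← Set.range_comp, ← Finsupp.range_linearCombination]
    rfl
  rw [this]
  exact hx

theorem norm_combination_eq (a : ι → H) (b : ι → K)
    (h : ∀ i j, inner ℂ (a i) (a j) = inner ℂ (b i) (b j)) (c : ι →₀ ℂ) :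
    ‖combination b c‖ = ‖combination a c‖ := by
  have e : inner ℂ (Finsupp.linearCombination ℂ b c) (Finsupp.linearCombination ℂ b c) =
      inner ℂ (Finsupp.linearCombination ℂ a c) (Finsupp.linearCombination ℂ a c) := by
    simp only [Finsupp.linearCombination_apply, Finsupp.sum, sum_inner, inner_sum, inner_smul_left,
      inner_smul_right, h]
  change ‖Finsupp.linearCombination ℂ b c‖ = ‖Finsupp.linearCombination ℂ a c‖
  rw [@norm_eq_sqrt_re_inner ℂ, @norm_eq_sqrt_re_inner ℂ, e]

/-- The unitary from the closed span of `a` to the closed span of `b` with `a i ↦ b i`. -/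
def gramUnitary [CompleteSpace H] [CompleteSpace K] (a : ι → H) (b : ι → K)
    (h : ∀ i j, inner ℂ (a i) (a j) = inner ℂ (b i) (b j)) : closedSpan a ≃ₗᵢ[ℂ] closedSpan b :=
  (LinearEquiv.refl ℂ (ι →₀ ℂ)).extendOfIsometry (combination a) (combination b)
    (denseRange_combination a) (denseRange_combination b) (norm_combination_eq a b h)

theorem gramUnitary_apply [CompleteSpace H] [CompleteSpace K] (a : ι → H) (b : ι → K)
    (h : ∀ i j, inner ℂ (a i) (a j) = inner ℂ (b i) (b j)) (i : ι) :
    gramUnitary a b h ⟨a i, mem_closedSpan a i⟩ = ⟨b i, mem_closedSpan b i⟩ := by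
  have ha : combination a (Finsupp.single i 1) = ⟨a i, mem_closedSpan a i⟩ := by
    ext; simp [combination]
  have hb : combination b (Finsupp.single i 1) = ⟨b i, mem_closedSpan b i⟩ := by
    ext; simp [combination]
  rw [← ha, ← hb]
  exact LinearEquiv.extendOfIsometry_eq _ _ _ _ _ _ _

end Gram

/-! ### The unitary extension and transfer functions -/

section Extension

variable {L U Y : Type*} [NormedAddCommGroup L] [InnerProductSpace ℂ L]
  [NormedAddCommGroup U] [InnerProductSpace ℂ U] [NormedAddCommGroup Y] [InnerProductSpace ℂ Y]

/-- Given a unitary `V : N₂ → N₁` between closed subspaces of `L ⊕ Y` and `L ⊕ U`, with orthogonal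
complements `M₂` and `M₁`, the unitary `n₂ ⊕ m₂ ⊕ m₁ ↦ V n₂ ⊕ m₁ ⊕ m₂`, written as an operator from
`L ⊕ (M₁ ⊕ Y)` to `L ⊕ (M₂ ⊕ U)`. A vector `l ⊕ (m₁ ⊕ y)` is sent to `l' ⊕ (m₂ ⊕ u)`, where
`l ⊕ y = n₂ + m₂` with `n₂ ∈ N₂`, `m₂ ∈ M₂`, and `l' ⊕ u = V n₂ + m₁`. -/
def swapExtension {N₂ : Submodule ℂ (HSum L Y)} {N₁ : Submodule ℂ (HSum L U)}
    [N₂.HasOrthogonalProjection] (V : N₂ ≃ₗᵢ[ℂ] N₁) :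
    HSum L (HSum N₁ᗮ Y) →L[ℂ] HSum L (HSum N₂ᗮ U) :=
  let ly : HSum L (HSum N₁ᗮ Y) →L[ℂ] HSum L Y := pairL fstL (sndL ∘L sndL)
  let lu : HSum L (HSum N₁ᗮ Y) →L[ℂ] HSum L U :=
    N₁.subtypeL ∘L V.toContinuousLinearEquiv.toContinuousLinearMap ∘L
      N₂.orthogonalProjectionOnto ∘L ly + N₁ᗮ.subtypeL ∘L fstL ∘L sndL
  pairL (fstL ∘L lu) (pairL (N₂ᗮ.orthogonalProjectionOnto ∘L ly) (sndL ∘L lu))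

variable [CompleteSpace L] {A B : Type*} [NormedAddCommGroup A] [InnerProductSpace ℂ A]
  [CompleteSpace A] [NormedAddCommGroup B] [InnerProductSpace ℂ B] [CompleteSpace B]

/-- `Q₂₂^* + Q₁₂^* (I - T Q₁₁^*)⁻¹ T Q₂₁^*`, where `Q₁₁`, `Q₁₂`, `Q₂₁`, `Q₂₂` are the entries of the
operator matrix of `Q : L ⊕ A → L ⊕ B`. -/
def adjointTransfer (Q : HSum L A →L[ℂ] HSum L B) (T : L →L[ℂ] L) : B →L[ℂ] A :=
  (block22 Q)† + (block12 Q)† ∘L Ring.inverse (1 - T ∘L (block11 Q)†) ∘L T ∘L (block21 Q)†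

end Extension

/-! ### Interpolation data, affiliation -/

section Data

variable {X : Type*} {Ψ : TestFunctions X} {ι U Y : Type*}
  [NormedAddCommGroup U] [InnerProductSpace ℂ U] [CompleteSpace U]
  [NormedAddCommGroup Y] [InnerProductSpace ℂ Y] [CompleteSpace Y]

/-- The node `z i` as an element of the set of nodes. -/
abbrev node (z : ι → X) (i : ι) : Set.range z := ⟨z i, i, rfl⟩

/-- `I - B_i B_j^* = Γ(z_i, z_j)(1 - E(z_i) E(z_j)^*)` for all `i`, `j`. -/
def DecomposesData (z : ι → X) (B : ι → (U →L[ℂ] Y))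
    (Γ : Set.range z → Set.range z → (Ψ.Cb →L[ℂ] (Y →L[ℂ] Y))) : Prop :=
  ∀ i j, 1 - B i ∘L (B j)† = Γ (node z i) (node z j) (1 - Ψ.E (z i) * star (Ψ.E (z j)))

/-- The function `f` is affiliated with the kernel `Γ` on the nodes: it has an Agler decomposition
`I - f(x) f(y)^* = Δ(x, y)(1 - E(x) E(y)^*)` on `X` with a completely positive kernel `Δ` that
agrees with `Γ` on the nodes. -/
def IsAffiliated (z : ι → X) (Γ : Set.range z → Set.range z → (Ψ.Cb →L[ℂ] (Y →L[ℂ] Y)))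
    (f : X → (U →L[ℂ] Y)) : Prop :=
  ∃ Δ : X → X → (Ψ.Cb →L[ℂ] (Y →L[ℂ] Y)), IsCompletelyPositive Δ ∧
    (∀ x y, 1 - f x ∘L (f y)† = Δ x y (1 - Ψ.E x * star (Ψ.E y))) ∧
    ∀ i j, Γ (node z i) (node z j) = Δ (z i) (z j)

variable {X₁ : Type*} [NormedAddCommGroup X₁] [InnerProductSpace ℂ X₁] [CompleteSpace X₁]

/-- `(X₁, μ, h)` is a Kolmogorov decomposition of `Γ`; here `μ` is a unital `*`-representation. -/
def IsKolmogorov {N : Type*} (Γ : N → N → (Ψ.Cb →L[ℂ] (Y →L[ℂ] Y)))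
    (μ : Ψ.Cb →⋆ₐ[ℂ] (X₁ →L[ℂ] X₁)) (h : N → (X₁ →L[ℂ] Y)) : Prop :=
  ∀ p q δ, Γ p q δ = h p ∘L μ δ ∘L (h q)†

/-! ### The auxiliary function -/

variable (z : ι → X) (B : ι → (U →L[ℂ] Y))
  (μ : Ψ.Cb →⋆ₐ[ℂ] (X₁ →L[ℂ] X₁)) (h : Set.range z → (X₁ →L[ℂ] Y))

/-- The space `L₁`, the closed span of the vectors `μ(δ) h(z_i)^* y`. -/
def L₁ : Submodule ℂ X₁ :=
  closedSpan fun p : Ψ.Cb × ι × Y => μ p.1 (((h (node z p.2.1))†) p.2.2)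

instance : CompleteSpace (L₁ z μ h) :=
  inferInstanceAs (CompleteSpace (closedSpan _))

theorem map_mem_L₁ (δ : Ψ.Cb) (x : X₁) (hx : x ∈ L₁ z μ h) : μ δ x ∈ L₁ z μ h := by
  have hx' : x ∈ closure (Submodule.span ℂ (Set.range fun p : Ψ.Cb × ι × Y =>
    μ p.1 (((h (node z p.2.1))†) p.2.2)) : Set X₁) := hx
  change μ δ x ∈ closure _
  refine map_mem_closure (μ δ).continuous hx' fun w hw => ?_
  refine Submodule.span_induction ?_ ?_ ?_ ?_ hw
  · rintro _ ⟨p, rfl⟩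
    refine Submodule.subset_span ⟨(δ * p.1, p.2), ?_⟩
    simp
  · simp
  · intro a b _ _ ha hb
    rw [map_add]
    exact add_mem ha hb
  · intro c a _ ha
    rw [map_smul]
    exact Submodule.smul_mem _ c ha

theorem mem_L₁ (δ : Ψ.Cb) (i : ι) (y : Y) : μ δ (((h (node z i))†) y) ∈ L₁ z μ h :=
  mem_closedSpan (fun p : Ψ.Cb × ι × Y => μ p.1 (((h (node z p.2.1))†) p.2.2)) (δ, i, y)

theorem adjoint_mem_L₁ (i : ι) (y : Y) : ((h (node z i))†) y ∈ L₁ z μ h := by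
  simpa using mem_L₁ z μ h 1 i y

/-- The restriction of `μ(δ)` to the reducing subspace `L₁`. -/
def rep (δ : Ψ.Cb) : L₁ z μ h →L[ℂ] L₁ z μ h :=
  (μ δ).restrict (map_mem_L₁ z μ h δ)

/-- The vector `h(z_i)^* y` of `L₁`. -/
def hvec (i : ι) (y : Y) : L₁ z μ h := ⟨((h (node z i))†) y, adjoint_mem_L₁ z μ h i y⟩

/-- The vector `μ(E(z_i))^* h(z_i)^* y ⊕ y`. -/
def vec₂ (p : ι × Y) : HSum (L₁ z μ h) Y :=
  WithLp.toLp 2 (((rep z μ h (Ψ.E (z p.1)))†) (hvec z μ h p.1 p.2), p.2)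

/-- The vector `h(z_i)^* y ⊕ B_i^* y`. -/
def vec₁ (p : ι × Y) : HSum (L₁ z μ h) U :=
  WithLp.toLp 2 (hvec z μ h p.1 p.2, ((B p.1)†) p.2)

/-- The space `N₂`. -/
abbrev N₂ : Submodule ℂ (HSum (L₁ z μ h) Y) := closedSpan (vec₂ z μ h)

/-- The space `N₁`. -/
abbrev N₁ : Submodule ℂ (HSum (L₁ z μ h) U) := closedSpan (vec₁ z B μ h)

/-- The space `M₂ = (L₁ ⊕ Y) ⊖ N₂`. -/
abbrev M₂ : Submodule ℂ (HSum (L₁ z μ h) Y) := (N₂ z μ h)ᗮ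

/-- The space `M₁ = (L₁ ⊕ U) ⊖ N₁`. -/
abbrev M₁ : Submodule ℂ (HSum (L₁ z μ h) U) := (N₁ z B μ h)ᗮ

variable {z B μ h} {Γ : Set.range z → Set.range z → (Ψ.Cb →L[ℂ] (Y →L[ℂ] Y))}

theorem inner_vec (hΓ : DecomposesData z B Γ) (hK : IsKolmogorov Γ μ h) (p q : ι × Y) :
    inner ℂ (vec₂ z μ h p) (vec₂ z μ h q) = inner ℂ (vec₁ z B μ h p) (vec₁ z B μ h q) := by
  obtain ⟨i, y⟩ := p
  obtain ⟨j, w⟩ := q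
  have hadj : ∀ (k : ι) (a : Y), (((rep z μ h (Ψ.E (z k)))†) (hvec z μ h k a) : X₁) =
      μ (star (Ψ.E (z k))) (((h (node z k))†) a) := by
    intro k a
    have : (rep z μ h (Ψ.E (z k)))† = rep z μ h (star (Ψ.E (z k))) := by
      symm
      rw [ContinuousLinearMap.eq_adjoint_iff]
      intro s t
      change inner ℂ (μ (star (Ψ.E (z k))) (s : X₁)) (t : X₁) =
        inner ℂ (s : X₁) (μ (Ψ.E (z k)) (t : X₁))
      rw [map_star, ContinuousLinearMap.star_eq_adjoint, ContinuousLinearMap.adjoint_inner_left]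
    rw [this]
    rfl
  have hd := congrArg (fun T : Y →L[ℂ] Y => inner ℂ y (T w)) (hΓ i j)
  simp only [hK _ _ _, map_sub, map_one, map_mul] at hd
  have e1 : inner ℂ y ((1 - B i ∘L (B j)†) w) =
      inner ℂ y w - inner ℂ (((B i)†) y) (((B j)†) w) := by
    rw [ContinuousLinearMap.adjoint_inner_left, ← inner_sub_right]
    rfl
  have e2 : inner ℂ y ((h (node z i) ∘L (1 - μ (Ψ.E (z i)) * μ (star (Ψ.E (z j)))) ∘L
        (h (node z j))†) w) =
      inner ℂ (((h (node z i))†) y) (((h (node z j))†) w) -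
        inner ℂ (μ (star (Ψ.E (z i))) (((h (node z i))†) y))
          (μ (star (Ψ.E (z j))) (((h (node z j))†) w)) := by
    rw [map_star μ (Ψ.E (z i)), ContinuousLinearMap.star_eq_adjoint,
      ContinuousLinearMap.adjoint_inner_left, ContinuousLinearMap.adjoint_inner_left,
      ContinuousLinearMap.adjoint_inner_left, ← inner_sub_right, ← map_sub]
    rfl
  have h2 : inner ℂ (vec₂ z μ h (i, y)) (vec₂ z μ h (j, w)) =
      inner ℂ (μ (star (Ψ.E (z i))) (((h (node z i))†) y))
        (μ (star (Ψ.E (z j))) (((h (node z j))†) w)) + inner ℂ y w := by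
    rw [← hadj, ← hadj]
    rfl
  have h1 : inner ℂ (vec₁ z B μ h (i, y)) (vec₁ z B μ h (j, w)) =
      inner ℂ (((h (node z i))†) y) (((h (node z j))†) w) +
        inner ℂ (((B i)†) y) (((B j)†) w) := rfl
  rw [h1, h2]
  rw [e1, e2] at hd
  linear_combination hd

/-- The unitary `V : N₂ → N₁` with `μ(E(z_i))^* h(z_i)^* y ⊕ y ↦ h(z_i)^* y ⊕ B_i^* y`. -/
def V (hΓ : DecomposesData z B Γ) (hK : IsKolmogorov Γ μ h) :
    N₂ z μ h ≃ₗᵢ[ℂ] N₁ z B μ h :=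
  gramUnitary (vec₂ z μ h) (vec₁ z B μ h) (inner_vec hΓ hK)

/-- The unitary `Q` from `L₁ ⊕ (M₁ ⊕ Y)` to `L₁ ⊕ (M₂ ⊕ U)` that extends `V` and exchanges `M₁` and
`M₂`. -/
def Q (hΓ : DecomposesData z B Γ) (hK : IsKolmogorov Γ μ h) :
    HSum (L₁ z μ h) (HSum (M₁ z B μ h) Y) →L[ℂ] HSum (L₁ z μ h) (HSum (M₂ z μ h) U) :=
  swapExtension (V hΓ hK)

/-- The auxiliary function
`G(x) = Q₂₂^* + Q₁₂^* (I - μ(E(x)) Q₁₁^*)⁻¹ μ(E(x)) Q₂₁^*`. -/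
def G (hΓ : DecomposesData z B Γ) (hK : IsKolmogorov Γ μ h) (x : X) :
    HSum (M₂ z μ h) U →L[ℂ] HSum (M₁ z B μ h) Y :=
  adjointTransfer (Q hΓ hK) (rep z μ h (Ψ.E x))

end Data

end SchurAgler

end

universe u v w

open SchurAgler

namespace SchurAgler

/-! The theorem is a lurking isometry argument. Factor `Δ(x,y)(δ) = h₂(x) μ₂(δ) h₂(y)*`. The Agler
decomposition of `f` then says that the vectors `ζ ⊕ y = μ₂(E(x))* h₂(x)* y ⊕ y` and `η ⊕ u = h₂(x)*
y ⊕ f(x)* y` have the same Gram matrix. As `Δ` agrees with `Γ` on the nodes, `L₁` embeds in the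
space of `μ₂` by an isometry `J` that intertwines the representations
(`exists_intertwining_isometry`), and at the nodes the passage from the first vectors to the second
is `V`.

Compress to `L₁` by `J†` and split along `N₂ ⊕ M₂` and `N₁ ⊕ M₁`. The components in `N₂` and `N₁`
correspond under `V`, so removing them from the Gram identity leaves another one: the part of `ζ`
orthogonal to `J L₁`, together with the `M₂` component `m₂`, has the same Gram matrix as the part of
`η` orthogonal to `J L₁`, together with the `M₁` component `m₁`. Hence a contraction `W` carries the
first pair to the second (`exists_contraction_feedback`). Thus `W` turns `m₂` into `m₁` while `Q`
turns `m₁` and `y` into `m₂` and `f(x)* y`. Taking `t` to be the transfer function of `W` with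
respect to `μ₂`, this coupling is the adjoint form of the feedback formula (`eq_feedback`).

The loop is solvable because `t(x)` is a contraction and `‖G₁₁(x)‖ ≤ ‖μ(E(x))‖ < 1`. The strict
bound combines the energy balance of `Q` with the fact that the `M₂` output of `Q` does not depend
on the `M₁` input (`norm_block11_adjointTransfer_le`).

Both `G` and `t` are transfer functions of contractions, hence in the Schur–Agler class
(`adjointTransfer_mem_schurAglerClass`): the state gives an Agler decomposition up to a positive
defect term. Tensoring with an admissible kernel preserves positivity, by complete positivity of
`*`-representations for the first term and by the Schur product theorem for the defect. -/

theorem inner_self_nonneg_complex {H : Type*} [NormedAddCommGroup H] [InnerProductSpace ℂ H]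
    (x : H) : 0 ≤ inner ℂ x x := by
  rw [inner_self_eq_norm_sq_to_K]
  have := (RCLike.ofReal_nonneg (K := ℂ)).2 (sq_nonneg ‖x‖)
  exact_mod_cast this

/-! ### Positive semidefinite matrices of functions -/

open scoped Matrix.Norms.L2Operator MatrixOrder in
/-- A matrix of bounded continuous functions that is positive semidefinite at each point is of the
form `b^* b`. -/
theorem exists_star_mul_of_pointwise_posSemidef {T ι : Type*} [TopologicalSpace T] [Fintype ι]
    (a : ι → ι → T →ᵇ ℂ) (h : ∀ t, (Matrix.of fun i j => a i j t).PosSemidef) :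
    ∃ b : ι → ι → T →ᵇ ℂ, ∀ i j, a i j = ∑ k, star (b k i) * b k j := by
  classical
  let A : T → Matrix ι ι ℂ := fun t => Matrix.of fun i j => a i j t
  have hA : Continuous A := by
    refine continuous_matrix fun i j => (a i j).continuous
  have hA0 : ∀ t, 0 ≤ A t := fun t => (h t).nonneg
  -- The matrix square root is continuous on positive matrices, so taking it pointwise stays inside
  -- the algebra of continuous functions.
  have hS : Continuous fun t => CFC.sqrt (A t) := CFC.continuousOn_sqrt.comp_continuous hA hA0
  have hmul : ∀ t i j, a i j t = ∑ k, star (CFC.sqrt (A t) k i) * CFC.sqrt (A t) k j := by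
    intro t i j
    have h1 : star (CFC.sqrt (A t)) * CFC.sqrt (A t) = A t := by
      rw [(CFC.sqrt_nonneg (A t)).isSelfAdjoint.star_eq, CFC.sqrt_mul_sqrt_self _ (hA0 t)]
    have h2 := congrFun (congrFun h1 i) j
    rw [Matrix.mul_apply] at h2
    exact h2.symm
  -- The diagonal entry `a i i` is the sum of the squared moduli in column `i` of the root, so it
  -- dominates each of them.
  have hbd : ∀ k i t, ‖CFC.sqrt (A t) k i‖ ≤ Real.sqrt ‖a i i‖ := by
    intro k i t
    refine Real.le_sqrt_of_sq_le ?_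
    have h1 : ((∑ k, ‖CFC.sqrt (A t) k i‖ ^ 2 : ℝ) : ℂ) = a i i t := by
      rw [hmul t i i]
      push_cast
      refine Finset.sum_congr rfl fun k _ => ?_
      exact (RCLike.conj_mul _).symm
    have h2 : ∑ k, ‖CFC.sqrt (A t) k i‖ ^ 2 = ‖a i i t‖ := by
      rw [← h1, Complex.norm_real, Real.norm_of_nonneg (Finset.sum_nonneg fun _ _ => sq_nonneg _)]
    calc ‖CFC.sqrt (A t) k i‖ ^ 2 ≤ ∑ k, ‖CFC.sqrt (A t) k i‖ ^ 2 :=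
          Finset.single_le_sum (f := fun k => ‖CFC.sqrt (A t) k i‖ ^ 2)
            (fun _ _ => sq_nonneg _) (Finset.mem_univ k)
      _ = ‖a i i t‖ := h2
      _ ≤ ‖a i i‖ := (a i i).norm_coe_le_norm t
  refine ⟨fun k i => BoundedContinuousFunction.ofNormedAddCommGroup
    (fun t => CFC.sqrt (A t) k i) (hS.matrix_elem k i) _ (hbd k i), fun i j => ?_⟩
  ext t
  rw [hmul t i j]
  simp

/-- Complete positivity of `*`-representations of algebras of bounded continuous functions. -/
theorem sum_inner_map_nonneg {T ι L : Type*} [TopologicalSpace T] [Fintype ι]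
    [NormedAddCommGroup L] [InnerProductSpace ℂ L] [CompleteSpace L]
    (μ : (T →ᵇ ℂ) →⋆ₐ[ℂ] (L →L[ℂ] L)) (a : ι → ι → T →ᵇ ℂ)
    (h : ∀ t, (Matrix.of fun i j => a i j t).PosSemidef) (w : ι → L) :
    0 ≤ ∑ i, ∑ j, inner ℂ (w i) (μ (a i j) (w j)) := by
  obtain ⟨b, hb⟩ := exists_star_mul_of_pointwise_posSemidef a h
  have key : ∑ i, ∑ j, inner ℂ (w i) (μ (a i j) (w j)) =
      ∑ k, inner ℂ (∑ i, μ (b k i) (w i)) (∑ j, μ (b k j) (w j)) := by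
    have : ∀ i j, inner ℂ (w i) (μ (a i j) (w j)) =
        ∑ k, inner ℂ (μ (b k i) (w i)) (μ (b k j) (w j)) := by
      intro i j
      rw [hb i j, map_sum, sum_apply, inner_sum]
      refine Finset.sum_congr rfl fun k _ => ?_
      rw [map_mul, map_star, ContinuousLinearMap.star_eq_adjoint,
        ← ContinuousLinearMap.adjoint_inner_right]
      rfl
    simp only [this, sum_inner, inner_sum]
    rw [Finset.sum_comm_cycle]
    refine Finset.sum_congr rfl fun k _ => Finset.sum_comm
  rw [key]
  exact Finset.sum_nonneg fun k _ => inner_self_nonneg_complex _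

open scoped Matrix.Norms.L2Operator MatrixOrder in
/-- The Schur product of a positive semidefinite matrix with a Gram matrix has nonnegative sum. -/
theorem sum_mul_inner_nonneg {ι L : Type*} [Fintype ι]
    [NormedAddCommGroup L] [InnerProductSpace ℂ L] (a : Matrix ι ι ℂ) (h : a.PosSemidef)
    (w : ι → L) : 0 ≤ ∑ i, ∑ j, inner ℂ (w i) (w j) * a i j := by
  classical
  obtain ⟨b, rfl⟩ := CStarAlgebra.nonneg_iff_eq_star_mul_self.1 h.nonneg
  have key : ∑ i, ∑ j, inner ℂ (w i) (w j) * (star b * b) i j =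
      ∑ k, inner ℂ (∑ i, b k i • w i) (∑ j, b k j • w j) := by
    have : ∀ i j, inner ℂ (w i) (w j) * (star b * b) i j =
        ∑ k, inner ℂ (b k i • w i) (b k j • w j) := by
      intro i j
      rw [Matrix.mul_apply, Finset.mul_sum]
      refine Finset.sum_congr rfl fun k _ => ?_
      rw [inner_smul_left, inner_smul_right, Matrix.star_apply, RCLike.star_def]
      ring
    simp only [this, sum_inner, inner_sum]
    rw [Finset.sum_comm_cycle]
    refine Finset.sum_congr rfl fun k _ => Finset.sum_comm
  rw [key]
  exact Finset.sum_nonneg fun k _ => inner_self_nonneg_complex _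

/-- The difference of two Gram matrices is positive semidefinite if the second family is the image
of the first one under a contraction. -/
theorem posSemidef_gram_sub_gram {ι H K : Type*} [Fintype ι] [NormedAddCommGroup H]
    [InnerProductSpace ℂ H] [NormedAddCommGroup K] [InnerProductSpace ℂ K] (T : H →L[ℂ] K)
    (hT : ‖T‖ ≤ 1) (a : ι → H) :
    (Matrix.of fun i j => inner ℂ (a i) (a j) - inner ℂ (T (a i)) (T (a j))).PosSemidef := by
  refine Matrix.PosSemidef.of_dotProduct_mulVec_nonneg ?_ fun c => ?_
  · ext i j
    simp [Matrix.conjTranspose_apply]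
  · have key : star c ⬝ᵥ (Matrix.of fun i j => inner ℂ (a i) (a j) -
        inner ℂ (T (a i)) (T (a j))).mulVec c =
        inner ℂ (∑ i, c i • a i) (∑ i, c i • a i) -
          inner ℂ (T (∑ i, c i • a i)) (T (∑ i, c i • a i)) := by
      simp only [dotProduct, Matrix.mulVec, Matrix.of_apply, map_sum, map_smul, sum_inner,
        inner_sum, inner_smul_left, inner_smul_right, ← Finset.sum_sub_distrib, Finset.mul_sum,
        Pi.star_apply, RCLike.star_def]
      rw [Finset.sum_comm]
      refine Finset.sum_congr rfl fun i _ => Finset.sum_congr rfl fun j _ => ?_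
      ring
    rw [key, inner_self_eq_norm_sq_to_K, inner_self_eq_norm_sq_to_K, sub_nonneg]
    have : ‖T (∑ i, c i • a i)‖ ≤ ‖∑ i, c i • a i‖ := by
      simpa using T.le_of_opNorm_le hT (∑ i, c i • a i)
    exact_mod_cast pow_le_pow_left₀ (norm_nonneg _) this 2

/-! ### Scalar matrices obtained from positive and admissible kernels -/

/-- For an admissible kernel `k`, the kernel `(1 - ψ(x) ψ(y)^*) k(x, y)` is positive. -/
theorem IsAdmissible.posSemidef {X H ι : Type*} [Fintype ι] [NormedAddCommGroup H]
    [InnerProductSpace ℂ H] [CompleteSpace H] {Ψ : TestFunctions X} {k : X → X → (H →L[ℂ] H)}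
    (hk : IsAdmissible Ψ k) {ψ : X → ℂ} (hψ : ψ ∈ Ψ.carrier) (x : ι → X) (e : ι → H) :
    (Matrix.of fun i j => (1 - ψ (x i) * star (ψ (x j))) *
      inner ℂ (e i) (k (x i) (x j) (e j))).PosSemidef := by
  obtain ⟨hK, hM⟩ := hk
  have : Fact (Matrix.of k).PosSemidef := ⟨hK.posSemidef⟩
  obtain ⟨M, hM1, hM2⟩ := hM ψ hψ
  let κ : X → H →L[ℂ] RKHS.OfKernel (Matrix.of k) := RKHS.kerFun _
  have h1 : ∀ x y v w, inner ℂ (κ x v) (κ y w) = inner ℂ v (k x y w) := by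
    intro x y v w
    rw [RKHS.kerFun_inner, RKHS.kerFun_apply, RKHS.OfKernel.kernel_ofKernel]
    rfl
  -- The adjoint of a multiplication operator scales kernel functions, so the Gram difference for
  -- the contraction `M†` produces the factor `1 - ψ(x) ψ(y)^*`.
  have h2 : ∀ x v, (M†) (κ x v) = star (ψ x) • κ x v := by
    intro x v
    refine ext_inner_right ℂ fun g => ?_
    rw [ContinuousLinearMap.adjoint_inner_left, inner_smul_left, RKHS.kerFun_inner,
      RKHS.kerFun_inner, hM2, inner_smul_right]
    simp
  have hM' : ‖M†‖ ≤ 1 := by rwa [LinearIsometryEquiv.norm_map]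
  convert posSemidef_gram_sub_gram (M†) hM' (fun i => κ (x i) (e i)) using 4 with i j
  rw [h2, h2, inner_smul_left, inner_smul_right, h1]
  simp
  ring

/-- The entries are inner products of kernel functions, so this is a Gram matrix; the zero
contraction makes the second term of `posSemidef_gram_sub_gram` vanish. -/
theorem IsPositiveKernel.posSemidef_inner {X H ι : Type*} [Fintype ι] [NormedAddCommGroup H]
    [InnerProductSpace ℂ H] [CompleteSpace H] {k : X → X → (H →L[ℂ] H)}
    (hk : IsPositiveKernel k) (x : ι → X) (e : ι → H) :
    (Matrix.of fun i j => inner ℂ (e i) (k (x i) (x j) (e j))).PosSemidef := by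
  have : Fact (Matrix.of k).PosSemidef := ⟨hk.posSemidef⟩
  let κ : X → H →L[ℂ] RKHS.OfKernel (Matrix.of k) := RKHS.kerFun _
  have h1 : ∀ x y v w, inner ℂ (κ x v) (κ y w) = inner ℂ v (k x y w) := by
    intro x y v w
    rw [RKHS.kerFun_inner, RKHS.kerFun_apply, RKHS.OfKernel.kernel_ofKernel]
    rfl
  convert posSemidef_gram_sub_gram (0 : _ →L[ℂ] RKHS.OfKernel (Matrix.of k)) (by simp)
    (fun i => κ (x i) (e i)) using 4 with i j
  simp [h1]

/-! ### Tensor products -/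

section Tensor

variable {H : Type u} {K : Type v} [NormedAddCommGroup H] [InnerProductSpace ℂ H]
  [NormedAddCommGroup K] [InnerProductSpace ℂ K]

theorem tensorOp_coe (S : H →L[ℂ] H) (T : K →L[ℂ] K) (t : H ⊗[ℂ] K) :
    tensorOp S T (t : HilbertTensor H K) =
      ((TensorProduct.mapL S T t : H ⊗[ℂ] K) : HilbertTensor H K) :=
  ContinuousLinearMap.extend_eq _ UniformSpace.Completion.denseRange_coe
    (UniformSpace.Completion.isUniformInducing_coe _) t

/-- Positivity of a tensor product of kernels can be checked on elementary tensors. -/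
theorem isPositiveKernel_tensorOp {X : Type*} (A : X → X → (H →L[ℂ] H)) (k : X → X → (K →L[ℂ] K))
    (h : ∀ (ι : Type (max u v)) [Fintype ι] (x : ι → X) (u : ι → H) (e : ι → K),
      0 ≤ ∑ i, ∑ j, inner ℂ (u i) (A (x i) (x j) (u j)) *
        inner ℂ (e i) (k (x i) (x j) (e j))) :
    IsPositiveKernel fun x y => tensorOp (A x y) (k x y) := by
  intro n x e
  -- Nonnegativity is a closed condition, so algebraic tensors suffice.
  have hd : DenseRange (Pi.map fun (_ : Fin n) (t : H ⊗[ℂ] K) => (t : HilbertTensor H K)) :=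
    DenseRange.piMap fun _ => UniformSpace.Completion.denseRange_coe
  refine hd.induction_on (p := fun e => 0 ≤ ∑ i, ∑ j,
    inner ℂ (e i) (tensorOp (A (x i) (x j)) (k (x i) (x j)) (e j))) e ?_ fun t => ?_
  · exact isClosed_le continuous_const (by fun_prop)
  -- Expanding every tensor repeats each point once per elementary summand. The new index set is a
  -- sigma type, which is why `h` allows arbitrary finite index types.
  · choose s hs using fun i => TensorProduct.exists_finset (t i)
    have key : ∑ i, ∑ j, inner ℂ (t i : HilbertTensor H K)
        (tensorOp (A (x i) (x j)) (k (x i) (x j)) (t j)) =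
        ∑ p : (Σ i, s i), ∑ q : (Σ i, s i), inner ℂ p.2.1.1 (A (x p.1) (x q.1) q.2.1.1) *
          inner ℂ p.2.1.2 (k (x p.1) (x q.1) q.2.1.2) := by
      simp only [tensorOp_coe, UniformSpace.Completion.inner_coe, Fintype.sum_sigma]
      refine Finset.sum_congr rfl fun i _ => ?_
      rw [Finset.sum_comm]
      refine Finset.sum_congr rfl fun j _ => ?_
      conv_lhs => rw [hs i, hs j]
      rw [map_sum, sum_inner, ← Finset.sum_coe_sort (s i)]
      refine Finset.sum_congr rfl fun p _ => ?_
      rw [inner_sum, ← Finset.sum_coe_sort (s j)]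
      refine Finset.sum_congr rfl fun q _ => ?_
      simp
    change 0 ≤ ∑ i, ∑ j, inner ℂ (t i : HilbertTensor H K)
        (tensorOp (A (x i) (x j)) (k (x i) (x j)) (t j))
    rw [key]
    exact h (Σ i, s i) (fun p => x p.1) (fun p => p.2.1.1) (fun p => p.2.1.2)

end Tensor

/-- A function with an Agler decomposition, up to a positive kernel that factors through a Hilbert
space, belongs to the Schur-Agler class. -/
theorem mem_schurAglerClass_of_decomposition {X U Y L W : Type*} {Ψ : TestFunctions X}
    [NormedAddCommGroup U] [InnerProductSpace ℂ U] [CompleteSpace U]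
    [NormedAddCommGroup Y] [InnerProductSpace ℂ Y] [CompleteSpace Y]
    [NormedAddCommGroup L] [InnerProductSpace ℂ L] [CompleteSpace L]
    [NormedAddCommGroup W] [InnerProductSpace ℂ W] [CompleteSpace W]
    (μ : Ψ.Cb →⋆ₐ[ℂ] (L →L[ℂ] L)) (S : X → (U →L[ℂ] Y)) (h : X → (L →L[ℂ] Y))
    (g : X → (W →L[ℂ] Y))
    (hS : ∀ x y, 1 - S x ∘L (S y)† =
      h x ∘L μ (1 - Ψ.E x * star (Ψ.E y)) ∘L (h y)† + g x ∘L (g y)†) :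
    S ∈ SchurAglerClass Ψ U Y := by
  intro k hk
  refine isPositiveKernel_tensorOp _ _ fun ι _ x u e => ?_
  let c : ι → ι → ℂ := fun i j => inner ℂ (e i) (k (x i) (x j) (e j))
  have key : ∑ i, ∑ j, inner ℂ (u i) ((1 - S (x i) ∘L (S (x j))†) (u j)) * c i j =
      ∑ i, ∑ j, inner ℂ (((h (x i))†) (u i))
        (μ (c i j • (1 - Ψ.E (x i) * star (Ψ.E (x j)))) (((h (x j))†) (u j))) +
      ∑ i, ∑ j, inner ℂ (((g (x i))†) (u i)) (((g (x j))†) (u j)) * c i j := by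
    simp only [← Finset.sum_add_distrib]
    refine Finset.sum_congr rfl fun i _ => Finset.sum_congr rfl fun j _ => ?_
    rw [hS, add_apply, inner_add_right, add_mul,
      ContinuousLinearMap.adjoint_inner_left, ContinuousLinearMap.adjoint_inner_left, map_smul,
      smul_apply, map_smul, inner_smul_right, mul_comm (c i j)]
    rfl
  change 0 ≤ ∑ i, ∑ j, inner ℂ (u i) ((1 - S (x i) ∘L (S (x j))†) (u j)) * c i j
  rw [key]
  -- With the scalars `c i j` absorbed into the functions, the matrix under `μ` is positive at each
  -- `ψ` by admissibility. The second sum is a Schur product with a Gram matrix.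
  refine add_nonneg (sum_inner_map_nonneg μ _ (fun ψ => ?_) _)
    (sum_mul_inner_nonneg (Matrix.of c) (hk.1.posSemidef_inner x e) _)
  convert hk.posSemidef ψ.2 x e using 4 with i j
  rw [BoundedContinuousFunction.smul_apply, smul_eq_mul, mul_comm]
  rfl

/-! ### Kolmogorov decompositions -/

/-- A completely positive kernel, as a positive kernel on `N × C_b(Ψ)`. -/
theorem IsCompletelyPositive.isPositiveKernel {X N H : Type*} [NormedAddCommGroup H]
    [InnerProductSpace ℂ H] [CompleteSpace H] {Ψ : TestFunctions X}
    {Γ : N → N → (Ψ.Cb →L[ℂ] (H →L[ℂ] H))} (hΓ : IsCompletelyPositive Γ) :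
    IsPositiveKernel fun p q : N × Ψ.Cb => Γ p.1 q.1 (star p.2 * q.2) := by
  intro n x e
  rcases subsingleton_or_nontrivial H with hH | hH
  · have he : ∀ i, e i = 0 := fun i => Subsingleton.elim _ _
    simp [he]
  -- Rank one operators `v ↦ e i` in the role of the `b i` turn operator positivity, tested at the
  -- unit vector `v`, into positivity for the vectors `e i`.
  · obtain ⟨v, hv⟩ := exists_norm_eq H zero_le_one
    have hb : ∀ i, star (InnerProductSpace.rankOne ℂ (e i) v) =
        InnerProductSpace.rankOne ℂ v (e i) := by
      intro i
      rw [ContinuousLinearMap.star_eq_adjoint, InnerProductSpace.adjoint_rankOne]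
    have h1 := (hΓ n (fun i => (x i).1) (fun i => (x i).2)
      (fun i => InnerProductSpace.rankOne ℂ (e i) v)).inner_nonneg_right v
    convert h1 using 1
    simp only [sum_apply, inner_sum]
    refine Finset.sum_congr rfl fun i _ => Finset.sum_congr rfl fun j _ => ?_
    rw [hb]
    simp [InnerProductSpace.rankOne_apply, inner_smul_right, inner_self_eq_norm_sq_to_K, hv]

/-- For every `δ` there is `g` with `g^* g + δ^* δ = ‖δ‖²`. -/
theorem exists_star_mul_add_star_mul_eq {T : Type*} [TopologicalSpace T] (δ : T →ᵇ ℂ) :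
    ∃ g : T →ᵇ ℂ, star g * g + star δ * δ = ((‖δ‖ ^ 2 : ℝ) : ℂ) • 1 := by
  have h : ∀ t, ‖δ t‖ ^ 2 ≤ ‖δ‖ ^ 2 := fun t =>
    pow_le_pow_left₀ (norm_nonneg _) (δ.norm_coe_le_norm t) 2
  refine ⟨BoundedContinuousFunction.ofNormedAddCommGroup
    (fun t => ((Real.sqrt (‖δ‖ ^ 2 - ‖δ t‖ ^ 2) : ℝ) : ℂ)) (by fun_prop) ‖δ‖ fun t => ?_, ?_⟩
  · rw [Complex.norm_real, Real.norm_of_nonneg (Real.sqrt_nonneg _)]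
    exact Real.sqrt_le_iff.2 ⟨norm_nonneg _, by nlinarith [sq_nonneg ‖δ t‖]⟩
  · ext t
    have h1 : star (δ t) * δ t = ((‖δ t‖ ^ 2 : ℝ) : ℂ) := by
      rw [RCLike.star_def, Complex.conj_mul', Complex.ofReal_pow]
    have h2 := Real.mul_self_sqrt (sub_nonneg.2 (h t))
    change star ((Real.sqrt (‖δ‖ ^ 2 - ‖δ t‖ ^ 2) : ℝ) : ℂ) *
      ((Real.sqrt (‖δ‖ ^ 2 - ‖δ t‖ ^ 2) : ℝ) : ℂ) + star (δ t) * δ t =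
      ((‖δ‖ ^ 2 : ℝ) : ℂ) * 1
    rw [h1, RCLike.star_def, Complex.conj_ofReal, ← Complex.ofReal_mul, h2]
    push_cast
    ring

/-- A family `κ` of vectors indexed by `A × I`, where `A` is an algebra of bounded continuous
functions, such that the inner product of `κ (a, i)` and `κ (b, j)` is a linear function
of `a^* b`, gives rise to a `*`-representation of `A` by translation of the first index. -/
theorem exists_representation {T I H : Type*} [TopologicalSpace T] [NormedAddCommGroup H]
    [InnerProductSpace ℂ H] [CompleteSpace H] (κ : (T →ᵇ ℂ) × I → H)
    (hκ : (Submodule.span ℂ (Set.range κ)).topologicalClosure = ⊤)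
    (φ : I → I → (T →ᵇ ℂ) →ₗ[ℂ] ℂ)
    (hφ : ∀ a i b j, inner ℂ (κ (a, i)) (κ (b, j)) = φ i j (star a * b)) :
    ∃ μ : (T →ᵇ ℂ) →⋆ₐ[ℂ] (H →L[ℂ] H), ∀ δ a i, μ δ (κ (a, i)) = κ (δ * a, i) := by
  let F : (T →ᵇ ℂ) → ((T →ᵇ ℂ) × I →₀ ℂ) →ₗ[ℂ] H := fun δ =>
    Finsupp.linearCombination ℂ fun p => κ (δ * p.1, p.2)
  let e : ((T →ᵇ ℂ) × I →₀ ℂ) →ₗ[ℂ] H := Finsupp.linearCombination ℂ κ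
  have he : DenseRange e := by
    have h1 : Set.range e = (Submodule.span ℂ (Set.range κ) : Set H) := by
      rw [← Finsupp.range_linearCombination]
      rfl
    rw [DenseRange, h1, Submodule.dense_iff_topologicalClosure_eq_top]
    exact hκ
  -- The relation `g^* g + δ^* δ = ‖δ‖²` splits `‖δ‖² ‖e c‖²` as `‖F g c‖² + ‖F δ c‖²`. The bound
  -- makes translation by `δ` well defined and continuous on the dense span.
  have hF : ∀ δ c, ‖F δ c‖ ≤ ‖δ‖ * ‖e c‖ := by
    intro δ c
    obtain ⟨g, hg⟩ := exists_star_mul_add_star_mul_eq δ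
    have h1 : inner ℂ (F g c) (F g c) + inner ℂ (F δ c) (F δ c) =
        ((‖δ‖ ^ 2 : ℝ) : ℂ) * inner ℂ (e c) (e c) := by
      simp only [F, e, Finsupp.linearCombination_apply, Finsupp.sum, sum_inner, inner_sum,
        inner_smul_left, inner_smul_right, hφ, ← Finset.sum_add_distrib, Finset.mul_sum]
      refine Finset.sum_congr rfl fun p _ => Finset.sum_congr rfl fun q _ => ?_
      have h2 : φ q.2 p.2 (star (g * q.1) * (g * p.1)) + φ q.2 p.2 (star (δ * q.1) * (δ * p.1)) =
          ((‖δ‖ ^ 2 : ℝ) : ℂ) * φ q.2 p.2 (star q.1 * p.1) := by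
        rw [← map_add, ← smul_eq_mul (((‖δ‖ ^ 2 : ℝ) : ℂ)), ← map_smul]
        congr 1
        rw [star_mul, star_mul]
        calc _ = (star g * g + star δ * δ) * (star q.1 * p.1) := by ring
          _ = _ := by rw [hg, smul_mul_assoc, one_mul]
      linear_combination (starRingEnd ℂ (c q)) * c p * h2
    have hre : ∀ x : H, (inner ℂ x x : ℂ).re = ‖x‖ ^ 2 := inner_self_eq_norm_sq (𝕜 := ℂ)
    have h3 : ‖F g c‖ ^ 2 + ‖F δ c‖ ^ 2 = ‖δ‖ ^ 2 * ‖e c‖ ^ 2 := by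
      have := congrArg Complex.re h1
      rwa [Complex.add_re, Complex.re_ofReal_mul, hre, hre, hre] at this
    refine (sq_le_sq₀ (norm_nonneg _) (by positivity)).1 ?_
    rw [mul_pow]
    nlinarith [sq_nonneg ‖F g c‖]
  let R : (T →ᵇ ℂ) → (H →L[ℂ] H) := fun δ => (F δ).extendOfNorm e
  have hR : ∀ δ p, R δ (κ p) = κ (δ * p.1, p.2) := by
    intro δ p
    have := LinearMap.extendOfNorm_eq he ⟨‖δ‖, hF δ⟩ (Finsupp.single p 1)
    simpa [F, e] using this
  have hext : ∀ S S' : H →L[ℂ] H, (∀ p, S (κ p) = S' (κ p)) → S = S' := by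
    intro S S' h
    refine ContinuousLinearMap.coeFn_injective (he.equalizer S.continuous S'.continuous ?_)
    funext c
    simp [e, Finsupp.linearCombination_apply, Finsupp.sum, h]
  have hinner : ∀ x y : H, (∀ p, inner ℂ (κ p) x = inner ℂ (κ p) y) → x = y := by
    intro x y h
    refine he.eq_of_inner_right ℂ fun c => ?_
    simp [e, Finsupp.linearCombination_apply, Finsupp.sum, sum_inner, inner_smul_left, h]
  -- Linearity of `κ` in its first index is forced by that of `φ`, since inner products with the
  -- family separate vectors.
  have hlin : ∀ (c d : ℂ) (a b : T →ᵇ ℂ) i, κ (c • a + d • b, i) = c • κ (a, i) + d • κ (b, i) := by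
    intro c d a b i
    refine hinner _ _ fun p => ?_
    rw [inner_add_right, inner_smul_right, inner_smul_right]
    obtain ⟨p, j⟩ := p
    simp [hφ, mul_add]
  refine ⟨{ toFun := R, map_one' := ?_, map_mul' := ?_, map_zero' := ?_, map_add' := ?_,
            commutes' := ?_, map_star' := ?_ }, fun δ a i => hR δ (a, i)⟩
  · exact hext _ _ fun p => by simp [hR]
  · exact fun a b => hext _ _ fun p => by simp [hR, mul_assoc]
  · refine hext _ _ fun p => ?_
    simpa [hR] using hlin 0 0 0 0 p.2
  · refine fun a b => hext _ _ fun p => ?_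
    simpa [hR, add_mul] using hlin 1 1 (a * p.1) (b * p.1) p.2
  · refine fun c => hext _ _ fun p => ?_
    simpa [hR, Algebra.algebraMap_eq_smul_one] using hlin c 0 p.1 0 p.2
  · refine fun δ => hext _ _ fun p => hinner _ _ fun q => ?_
    rw [ContinuousLinearMap.star_eq_adjoint, ContinuousLinearMap.adjoint_inner_right, hR, hR]
    obtain ⟨p, i⟩ := p
    obtain ⟨q, j⟩ := q
    rw [hφ, hφ, star_mul]
    congr 1
    ring

/-- Completely positive kernels have Kolmogorov decompositions. -/
theorem IsCompletelyPositive.exists_isKolmogorov {X : Type u} {N : Type w} {Y : Type v}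
    [NormedAddCommGroup Y] [InnerProductSpace ℂ Y] [CompleteSpace Y] {Ψ : TestFunctions X}
    {Γ : N → N → (Ψ.Cb →L[ℂ] (Y →L[ℂ] Y))} (hΓ : IsCompletelyPositive Γ) :
    ∃ (X₁ : Type (max u v w)) (_ : NormedAddCommGroup X₁) (_ : InnerProductSpace ℂ X₁)
      (_ : CompleteSpace X₁) (μ : Ψ.Cb →⋆ₐ[ℂ] (X₁ →L[ℂ] X₁)) (h : N → (X₁ →L[ℂ] Y)),
      IsKolmogorov Γ μ h := by
  let K : Matrix (N × Ψ.Cb) (N × Ψ.Cb) (Y →L[ℂ] Y) :=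
    Matrix.of fun p q : N × Ψ.Cb => Γ p.1 q.1 (star p.2 * q.2)
  have : Fact K.PosSemidef := ⟨hΓ.isPositiveKernel.posSemidef⟩
  let κ : N × Ψ.Cb → Y →L[ℂ] RKHS.OfKernel K := RKHS.kerFun _
  have h1 : ∀ p q v w, inner ℂ (κ p v) (κ q w) = inner ℂ v (K p q w) := by
    intro p q v w
    rw [RKHS.kerFun_inner, RKHS.kerFun_apply, RKHS.OfKernel.kernel_ofKernel]
  let κ' : Ψ.Cb × (N × Y) → RKHS.OfKernel K := fun t => κ (t.2.1, t.1) t.2.2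
  have hd : (Submodule.span ℂ (Set.range κ')).topologicalClosure = ⊤ := by
    rw [← RKHS.kerFun_dense (RKHS.OfKernel K)]
    congr 2
    ext f
    constructor
    · rintro ⟨t, rfl⟩
      exact ⟨_, _, rfl⟩
    · rintro ⟨p, y, rfl⟩
      exact ⟨(p.2, (p.1, y)), rfl⟩
  obtain ⟨μ, hμ⟩ := exists_representation κ' hd
    (fun s t => ((innerSL ℂ s.2).comp (((ContinuousLinearMap.apply ℂ Y t.2)).comp
      (Γ s.1 t.1))).toLinearMap) (by
      intro a s b t
      exact h1 _ _ _ _)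
  -- The vectors at the unit function generate the family: `μ δ` moves the index `1` to `δ`.
  refine ⟨RKHS.OfKernel K, inferInstance, inferInstance, inferInstance, μ, fun p => (κ (p, 1))†,
    fun p q δ => ?_⟩
  refine ContinuousLinearMap.ext fun y => ext_inner_left ℂ fun v => ?_
  have h2 : μ δ (κ (q, 1) y) = κ (q, δ) y := by simpa [κ'] using hμ δ 1 (q, y)
  rw [ContinuousLinearMap.comp_apply, ContinuousLinearMap.comp_apply,
    ContinuousLinearMap.adjoint_adjoint, ContinuousLinearMap.adjoint_inner_right, h2, h1]
  simp [K]

/-! ### Transfer functions of contractions -/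

/-- The defect `1 - T†T` of a contraction is positive, hence equal to `D†D`. With the term in `D`, a
contraction satisfies the same kind of Gram identity as an isometry. -/
theorem exists_inner_eq_inner_add_inner {H K : Type*} [NormedAddCommGroup H]
    [InnerProductSpace ℂ H] [CompleteSpace H] [NormedAddCommGroup K] [InnerProductSpace ℂ K]
    [CompleteSpace K] (T : H →L[ℂ] K) (hT : ‖T‖ ≤ 1) :
    ∃ D : H →L[ℂ] H, ∀ x y, inner ℂ x y = inner ℂ (T x) (T y) + inner ℂ (D x) (D y) := by
  have hp : 0 ≤ 1 - T† ∘L T := by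
    rw [ContinuousLinearMap.nonneg_iff_isPositive]
    refine ⟨?_, fun x => ?_⟩
    · intro x y
      simp [inner_sub_left, inner_sub_right, ContinuousLinearMap.adjoint_inner_left,
        ContinuousLinearMap.adjoint_inner_right]
    · have : ‖T x‖ ≤ ‖x‖ := by simpa using T.le_of_opNorm_le hT x
      have h2 := pow_le_pow_left₀ (norm_nonneg _) this 2
      rw [ContinuousLinearMap.reApplyInnerSelf_apply]
      have h3 : inner ℂ ((1 - T† ∘L T) x) x = inner ℂ x x - inner ℂ (T x) (T x) := by
        simp [ContinuousLinearMap.adjoint_inner_left]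
      rw [h3, map_sub, inner_self_eq_norm_sq, inner_self_eq_norm_sq]
      linarith
  obtain ⟨D, hD⟩ := CStarAlgebra.nonneg_iff_eq_star_mul_self.1 hp
  refine ⟨D, fun x y => ?_⟩
  have h1 : inner ℂ x ((1 - T† ∘L T) y) = inner ℂ x ((star D * D) y) := by rw [hD]
  have h2 : inner ℂ x ((1 - T† ∘L T) y) = inner ℂ x y - inner ℂ (T x) (T y) := by
    simp [ContinuousLinearMap.adjoint_inner_right]
  have h3 : inner ℂ x ((star D * D) y) = inner ℂ (D x) (D y) := by
    rw [ContinuousLinearMap.star_eq_adjoint, ContinuousLinearMap.mul_def,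
      ContinuousLinearMap.comp_apply, ContinuousLinearMap.adjoint_inner_right]
  linear_combination h2.symm.trans (h1.trans h3)

theorem norm_le_of_norm_adjoint_apply_le {H K : Type*} [NormedAddCommGroup H]
    [InnerProductSpace ℂ H] [CompleteSpace H] [NormedAddCommGroup K] [InnerProductSpace ℂ K]
    [CompleteSpace K] (T : H →L[ℂ] K) {c : ℝ} (hc : 0 ≤ c) (h : ∀ x, ‖(T†) x‖ ≤ c * ‖x‖) :
    ‖T‖ ≤ c := by
  rw [← LinearIsometryEquiv.norm_map ContinuousLinearMap.adjoint T]
  exact ContinuousLinearMap.opNorm_le_bound _ hc h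

/-- Neumann series. This is the solvability of the feedback loop; only one of the two factors has to
be strictly contractive. -/
theorem isUnit_one_sub_comp {H K : Type*} [NormedAddCommGroup H] [NormedSpace ℂ H]
    [CompleteSpace H] [NormedAddCommGroup K] [NormedSpace ℂ K] (S : K →L[ℂ] H) (T : H →L[ℂ] K)
    (hS : ‖S‖ ≤ 1) (hT : ‖T‖ < 1) : IsUnit (1 - S ∘L T) :=
  isUnit_one_sub_of_norm_lt_one (x := S ∘L T) <|
    (ContinuousLinearMap.opNorm_comp_le _ _).trans_lt <|
      (mul_le_of_le_one_left (norm_nonneg _) hS).trans_lt hT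

/-! ### Operator matrices on orthogonal sums and the feedback connection -/

section Blocks

variable {A B C D : Type*} [NormedAddCommGroup A] [InnerProductSpace ℂ A]
  [NormedAddCommGroup B] [InnerProductSpace ℂ B] [NormedAddCommGroup C] [InnerProductSpace ℂ C]
  [NormedAddCommGroup D] [InnerProductSpace ℂ D]

theorem inner_toLp (a a' : A) (b b' : B) :
    inner ℂ (WithLp.toLp 2 (a, b) : HSum A B) (WithLp.toLp 2 (a', b')) =
      inner ℂ a a' + inner ℂ b b' := rfl

theorem norm_sq_toLp (a : A) (b : B) :
    ‖(WithLp.toLp 2 (a, b) : HSum A B)‖ ^ 2 = ‖a‖ ^ 2 + ‖b‖ ^ 2 :=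
  WithLp.prod_norm_sq_eq_of_L2 _

theorem apply_toLp_eq (T : HSum A B →L[ℂ] HSum C D) (a : A) (b : B) :
    T (WithLp.toLp 2 (a, b)) =
      WithLp.toLp 2 (block11 T a + block12 T b, block21 T a + block22 T b) := by
  have h : (WithLp.toLp 2 (a, b) : HSum A B) = inlL a + inrL b := by
    change _ = WithLp.toLp 2 (a, (0 : B)) + WithLp.toLp 2 ((0 : A), b)
    rw [← WithLp.toLp_add]
    simp
  rw [h, map_add]
  rfl

theorem norm_block11_le (T : HSum A B →L[ℂ] HSum C D) : ‖block11 T‖ ≤ ‖T‖ := by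
  refine ContinuousLinearMap.opNorm_le_bound _ (norm_nonneg T) fun a => ?_
  have h1 := norm_sq_toLp (block11 T a) (block21 T a)
  have h2 : T (WithLp.toLp 2 (a, (0 : B))) = WithLp.toLp 2 (block11 T a, block21 T a) := by
    rw [apply_toLp_eq]
    simp
  rw [← h2] at h1
  have h4 : ‖(WithLp.toLp 2 (a, (0 : B)) : HSum A B)‖ = ‖a‖ := by
    refine (sq_eq_sq₀ (norm_nonneg _) (norm_nonneg _)).1 ?_
    simp
  have h5 := T.le_opNorm (WithLp.toLp 2 (a, (0 : B)))
  rw [h4] at h5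
  refine le_trans ?_ h5
  refine (sq_le_sq₀ (norm_nonneg _) (norm_nonneg _)).1 ?_
  rw [h1]
  linarith [sq_nonneg ‖block21 T a‖]

variable [CompleteSpace A] [CompleteSpace B] [CompleteSpace C] [CompleteSpace D]

theorem adjoint_apply_toLp (T : HSum A B →L[ℂ] HSum C D) (c : C) (d : D) :
    (T†) (WithLp.toLp 2 (c, d)) = WithLp.toLp 2
      (((block11 T)†) c + ((block21 T)†) d, ((block12 T)†) c + ((block22 T)†) d) := by
  refine ext_inner_right ℂ fun v => ?_
  obtain ⟨a, b⟩ := v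
  rw [ContinuousLinearMap.adjoint_inner_left, apply_toLp_eq, inner_toLp, inner_toLp]
  simp only [inner_add_left, inner_add_right, ContinuousLinearMap.adjoint_inner_left]
  ring

/-- The feedback connection of `G` and `t`, characterized through solutions of the adjoint
system. -/
theorem eq_feedback (G : HSum A B →L[ℂ] HSum C D) (t : C →L[ℂ] A) (F : B →L[ℂ] D)
    (hu : IsUnit (1 - t ∘L block11 G))
    (h : ∀ y, ∃ a, (G†) (WithLp.toLp 2 ((t†) a, y)) = WithLp.toLp 2 (a, (F†) y)) :
    F = block22 G + block21 G ∘L Ring.inverse (1 - t ∘L block11 G) ∘L t ∘L block12 G := by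
  refine (ContinuousLinearMap.adjoint (𝕜 := ℂ)).injective (ContinuousLinearMap.ext fun y => ?_)
  obtain ⟨a, ha⟩ := h y
  rw [adjoint_apply_toLp] at ha
  have h1 : ((block11 G)†) ((t†) a) + ((block21 G)†) y = a :=
    congrArg (fun v : HSum A B => v.fst) ha
  have h2 : ((block12 G)†) ((t†) a) + ((block22 G)†) y = (F†) y :=
    congrArg (fun v : HSum A B => v.snd) ha
  -- The first component of the system determines the loop signal `a` from `y` by inverting `(1 - t
  -- G₁₁)†`; substituting it into the second component gives the formula.
  have h3 : ((1 - t ∘L block11 G)†) a = ((block21 G)†) y := by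
    rw [map_sub, ContinuousLinearMap.adjoint_comp]
    change ((ContinuousLinearMap.id ℂ A)†) a - ((block11 G)†) ((t†) a) = _
    rw [ContinuousLinearMap.adjoint_id]
    exact sub_eq_iff_eq_add'.2 h1.symm
  have h4 : ((Ring.inverse (1 - t ∘L block11 G))†) (((1 - t ∘L block11 G)†) a) = a := by
    have h5 := Ring.mul_inverse_cancel _ hu
    have h6 := congrArg star h5
    rw [star_mul, star_one] at h6
    exact congrArg (fun S : A →L[ℂ] A => S a) h6
  rw [h3] at h4
  simp only [map_add, ContinuousLinearMap.adjoint_comp, add_apply,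
    ContinuousLinearMap.comp_apply, h4]
  rw [← h2, add_comm]

end Blocks

/-! ### State equations and energy balance of a transfer function -/

section Transfer

variable {L A B : Type*} [NormedAddCommGroup L] [InnerProductSpace ℂ L] [CompleteSpace L]
  [NormedAddCommGroup A] [InnerProductSpace ℂ A] [CompleteSpace A]
  [NormedAddCommGroup B] [InnerProductSpace ℂ B] [CompleteSpace B]
  (Q : HSum L A →L[ℂ] HSum L B) (T : L →L[ℂ] L)

theorem isUnit_one_sub_comp_adjoint_block11 (hQ : ‖Q‖ ≤ 1) (hT : ‖T‖ < 1) :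
    IsUnit (1 - T ∘L (block11 Q)†) := by
  refine isUnit_one_sub_of_norm_lt_one (x := T ∘L (block11 Q)†) ?_
  calc ‖T ∘L (block11 Q)†‖ ≤ ‖T‖ * ‖(block11 Q)†‖ := ContinuousLinearMap.opNorm_comp_le _ _
    _ ≤ ‖T‖ * 1 := by
      refine mul_le_mul_of_nonneg_left ?_ (norm_nonneg _)
      rw [LinearIsometryEquiv.norm_map]
      exact (norm_block11_le Q).trans hQ
    _ < 1 := by rwa [mul_one]

/-- The state `η` that solves `Q (T^* η ⊕ a) = η ⊕ b`, as a function of `a`. -/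
noncomputable def state : A →L[ℂ] L := (Ring.inverse (1 - T ∘L (block11 Q)†))† ∘L block12 Q

variable {Q T}

/-- Uniqueness of the state: the equation is `(1 - T Q₁₁†)† η = Q₁₂ a`, with an invertible operator
on the left. -/
theorem eq_state (hu : IsUnit (1 - T ∘L (block11 Q)†)) {η : L} {a : A}
    (h : η = block11 Q ((T†) η) + block12 Q a) : η = state Q T a := by
  have h3 : ((1 - T ∘L (block11 Q)†)†) η = block12 Q a := by
    rw [map_sub, ContinuousLinearMap.adjoint_comp, ContinuousLinearMap.adjoint_adjoint]
    change ((ContinuousLinearMap.id ℂ L)†) η - block11 Q ((T†) η) = _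
    rw [ContinuousLinearMap.adjoint_id]
    exact sub_eq_iff_eq_add'.2 h
  have h6 := congrArg star (Ring.mul_inverse_cancel _ hu)
  rw [star_mul, star_one] at h6
  have h7 := congrArg (fun S : L →L[ℂ] L => S η) h6
  rw [state, ContinuousLinearMap.comp_apply, ← h3]
  exact h7.symm

theorem state_eq (hu : IsUnit (1 - T ∘L (block11 Q)†)) (a : A) :
    state Q T a = block11 Q ((T†) (state Q T a)) + block12 Q a := by
  have h6 := congrArg star (Ring.inverse_mul_cancel _ hu)
  rw [star_mul, star_one] at h6
  have h7 : ((1 - T ∘L (block11 Q)†)†) (state Q T a) = block12 Q a :=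
    congrArg (fun S : L →L[ℂ] L => S (block12 Q a)) h6
  rw [map_sub, ContinuousLinearMap.adjoint_comp, ContinuousLinearMap.adjoint_adjoint] at h7
  change ((ContinuousLinearMap.id ℂ L)†) (state Q T a) - block11 Q ((T†) (state Q T a)) = _ at h7
  rw [ContinuousLinearMap.adjoint_id] at h7
  exact sub_eq_iff_eq_add'.1 h7

theorem adjoint_adjointTransfer_apply (a : A) :
    ((adjointTransfer Q T)†) a = block21 Q ((T†) (state Q T a)) + block22 Q a := by
  rw [adjointTransfer]
  simp only [map_add, ContinuousLinearMap.adjoint_comp, ContinuousLinearMap.adjoint_adjoint,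
    add_apply, ContinuousLinearMap.comp_apply, state]
  rw [add_comm]

theorem apply_state (hu : IsUnit (1 - T ∘L (block11 Q)†)) (a : A) :
    Q (WithLp.toLp 2 ((T†) (state Q T a), a)) =
      WithLp.toLp 2 (state Q T a, ((adjointTransfer Q T)†) a) := by
  rw [apply_toLp_eq, ← state_eq hu, adjoint_adjointTransfer_apply]

/-- By uniqueness of the state, exhibiting any solution of the system identifies the value of the
adjoint transfer function without computing an inverse. -/
theorem adjoint_adjointTransfer_eq (hu : IsUnit (1 - T ∘L (block11 Q)†)) {η : L} {a : A} {b : B}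
    (h : Q (WithLp.toLp 2 ((T†) η, a)) = WithLp.toLp 2 (η, b)) :
    ((adjointTransfer Q T)†) a = b := by
  rw [apply_toLp_eq] at h
  have h1 : block11 Q ((T†) η) + block12 Q a = η := congrArg (fun v : HSum L B => v.fst) h
  have h2 : block21 Q ((T†) η) + block22 Q a = b := congrArg (fun v : HSum L B => v.snd) h
  rw [adjoint_adjointTransfer_apply, ← eq_state hu h1.symm, h2]

/-- Energy balance: the contraction `Q` carries the old state and the input to the new state and the
output. -/
theorem norm_sq_state_add_le (hQ : ‖Q‖ ≤ 1) (hT : ‖T‖ < 1) (a : A) :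
    ‖state Q T a‖ ^ 2 + ‖((adjointTransfer Q T)†) a‖ ^ 2 ≤
      ‖(T†) (state Q T a)‖ ^ 2 + ‖a‖ ^ 2 := by
  have hu := isUnit_one_sub_comp_adjoint_block11 Q T hQ hT
  rw [← norm_sq_toLp, ← norm_sq_toLp, ← apply_state hu]
  refine pow_le_pow_left₀ (norm_nonneg _) ?_ 2
  simpa using Q.le_of_opNorm_le hQ (WithLp.toLp 2 ((T†) (state Q T a), a))

theorem norm_adjoint_state_le (a : A) :
    ‖(T†) (state Q T a)‖ ≤ ‖T‖ * ‖state Q T a‖ :=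
  ContinuousLinearMap.le_of_opNorm_le _ (LinearIsometryEquiv.norm_map _ T).le _

theorem norm_adjointTransfer_le_one (hQ : ‖Q‖ ≤ 1) (hT : ‖T‖ < 1) :
    ‖adjointTransfer Q T‖ ≤ 1 := by
  refine norm_le_of_norm_adjoint_apply_le _ zero_le_one fun a => ?_
  have h1 := norm_sq_state_add_le hQ hT a
  have h2 : ‖(T†) (state Q T a)‖ ≤ ‖state Q T a‖ :=
    (norm_adjoint_state_le a).trans (mul_le_of_le_one_left (norm_nonneg _) hT.le)
  have h3 := pow_le_pow_left₀ (norm_nonneg _) h2 2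
  rw [one_mul]
  exact (sq_le_sq₀ (norm_nonneg _) (norm_nonneg _)).1 (by linarith)

end Transfer

/-! ### Strict corner bound, Schur–Agler membership and feedback for transfer functions -/

/-- If the component `B` of `Q (l ⊕ (a ⊕ 0))` is bounded by `l`, then the corner `B → A` of the
transfer function of the contraction `Q` is a strict contraction. -/
theorem norm_block11_adjointTransfer_le {L A B U Y : Type*}
    [NormedAddCommGroup L] [InnerProductSpace ℂ L] [CompleteSpace L]
    [NormedAddCommGroup A] [InnerProductSpace ℂ A] [CompleteSpace A]
    [NormedAddCommGroup B] [InnerProductSpace ℂ B] [CompleteSpace B]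
    [NormedAddCommGroup U] [InnerProductSpace ℂ U] [CompleteSpace U]
    [NormedAddCommGroup Y] [InnerProductSpace ℂ Y] [CompleteSpace Y]
    {Q : HSum L (HSum A Y) →L[ℂ] HSum L (HSum B U)} (hQ : ‖Q‖ ≤ 1)
    (hQ' : ∀ l a, ‖(Q (WithLp.toLp 2 (l, WithLp.toLp 2 (a, 0)))).snd.fst‖ ≤ ‖l‖)
    {T : L →L[ℂ] L} (hT : ‖T‖ < 1) : ‖block11 (adjointTransfer Q T)‖ ≤ ‖T‖ := by
  refine norm_le_of_norm_adjoint_apply_le _ (norm_nonneg T) fun m => ?_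
  set a : HSum A Y := WithLp.toLp 2 (m, 0)
  set η := state Q T a
  have h1 := norm_sq_state_add_le hQ hT a
  have h2 : ‖(T†) η‖ ≤ ‖T‖ * ‖η‖ := norm_adjoint_state_le a
  have h3 : Q (WithLp.toLp 2 ((T†) η, a)) = WithLp.toLp 2 (η, ((adjointTransfer Q T)†) a) :=
    apply_state (isUnit_one_sub_comp_adjoint_block11 _ T hQ hT) a
  -- A second bound on the output in `B`, by the incoming state `T† η` alone, independent of the
  -- energy balance.
  have h4 := hQ' ((T†) η) m
  have h5 : ((adjointTransfer Q T)†) a = WithLp.toLp 2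
      (((block11 (adjointTransfer Q T))†) m, ((block12 (adjointTransfer Q T))†) m) := by
    rw [adjoint_apply_toLp]
    simp
  rw [h3, h5] at h4
  change ‖((block11 (adjointTransfer Q T))†) m‖ ≤ _ at h4
  rw [h5, norm_sq_toLp, norm_sq_toLp] at h1
  change ‖η‖ ^ 2 + _ ≤ ‖(T†) η‖ ^ 2 + _ at h1
  have h7 := pow_le_pow_left₀ (norm_nonneg _) h4 2
  have h8 := pow_le_pow_left₀ (norm_nonneg _) h2 2
  rw [mul_pow] at h8
  refine (sq_le_sq₀ (norm_nonneg _) (by positivity)).1 ?_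
  rw [mul_pow]
  have h9 : ‖T‖ ^ 2 ≤ 1 := pow_le_one₀ (norm_nonneg _) hT.le
  rw [norm_zero] at h1
  -- Weight the energy balance by `‖T‖²` and the bound `h7` by `1 - ‖T‖²`. In the sum, `‖T† η‖² ≤
  -- ‖T‖² ‖η‖²` cancels the state terms.
  nlinarith [mul_le_mul_of_nonneg_left h1 (sq_nonneg ‖T‖),
    mul_le_mul_of_nonneg_left h7 (sub_nonneg.2 h9),
    mul_nonneg (sq_nonneg ‖T‖) (sq_nonneg ‖((block12 (adjointTransfer Q T))†) m‖)]

theorem TestFunctions.norm_E_lt_one {X : Type*} (Ψ : TestFunctions X) (x : X) : ‖Ψ.E x‖ < 1 := by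
  obtain ⟨r, hr, h⟩ := Ψ.sup_lt_one x
  refine lt_of_le_of_lt ?_ (max_lt hr one_pos)
  exact (BoundedContinuousFunction.norm_le (le_max_right _ _)).2
    fun ψ => (h _ ψ.2).trans (le_max_left _ _)

theorem norm_map_E_lt_one {X L : Type*} {Ψ : TestFunctions X} [NormedAddCommGroup L]
    [InnerProductSpace ℂ L] [CompleteSpace L] (μ : Ψ.Cb →⋆ₐ[ℂ] (L →L[ℂ] L)) (x : X) :
    ‖μ (Ψ.E x)‖ < 1 :=
  (NonUnitalStarAlgHom.norm_apply_le μ _).trans_lt (Ψ.norm_E_lt_one x)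

/-- Transfer functions of contractions belong to the Schur-Agler class. -/
theorem adjointTransfer_mem_schurAglerClass {X L A B : Type*} {Ψ : TestFunctions X}
    [NormedAddCommGroup L] [InnerProductSpace ℂ L] [CompleteSpace L]
    [NormedAddCommGroup A] [InnerProductSpace ℂ A] [CompleteSpace A]
    [NormedAddCommGroup B] [InnerProductSpace ℂ B] [CompleteSpace B]
    (μ : Ψ.Cb →⋆ₐ[ℂ] (L →L[ℂ] L)) (Q : HSum L A →L[ℂ] HSum L B) (hQ : ‖Q‖ ≤ 1) :
    (fun x => adjointTransfer Q (μ (Ψ.E x))) ∈ SchurAglerClass Ψ B A := by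
  obtain ⟨D, hD⟩ := exists_inner_eq_inner_add_inner Q hQ
  let s : X → A →L[ℂ] L := fun x => state Q (μ (Ψ.E x))
  -- The defect of `Q` along the trajectory; its Gram kernel is the extra positive term in the
  -- decomposition.
  let F : X → A →L[ℂ] HSum L A := fun x =>
    D ∘L pairL ((μ (Ψ.E x))† ∘L s x) (ContinuousLinearMap.id ℂ A)
  have hF : ∀ x a, F x a = D (WithLp.toLp 2 (((μ (Ψ.E x))†) (s x a), a)) := fun _ _ => rfl
  refine mem_schurAglerClass_of_decomposition μ _ (fun x => (s x)†) (fun x => (F x)†)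
    fun x y => ?_
  refine ContinuousLinearMap.ext fun b => ext_inner_left ℂ fun a => ?_
  have hx := apply_state (isUnit_one_sub_comp_adjoint_block11 Q _ hQ (norm_map_E_lt_one μ x)) a
  have hy := apply_state (isUnit_one_sub_comp_adjoint_block11 Q _ hQ (norm_map_E_lt_one μ y)) b
  have h1 := hD (WithLp.toLp 2 (((μ (Ψ.E x))†) (s x a), a))
    (WithLp.toLp 2 (((μ (Ψ.E y))†) (s y b), b))
  rw [hx, hy, inner_toLp, inner_toLp, ← hF, ← hF] at h1
  have e1 : inner ℂ a ((1 - adjointTransfer Q (μ (Ψ.E x)) ∘L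
      (adjointTransfer Q (μ (Ψ.E y)))†) b) = inner ℂ a b -
        inner ℂ (((adjointTransfer Q (μ (Ψ.E x)))†) a) (((adjointTransfer Q (μ (Ψ.E y)))†) b) := by
    rw [ContinuousLinearMap.adjoint_inner_left, ← inner_sub_right]
    rfl
  have e2 : inner ℂ a (((s x)† ∘L μ (1 - Ψ.E x * star (Ψ.E y)) ∘L s y) b) =
      inner ℂ (s x a) (s y b) -
        inner ℂ (((μ (Ψ.E x))†) (s x a)) (((μ (Ψ.E y))†) (s y b)) := by
    rw [ContinuousLinearMap.comp_apply, ContinuousLinearMap.adjoint_inner_right,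
      ContinuousLinearMap.adjoint_inner_left, ← inner_sub_right, map_sub, map_one, map_mul,
      map_star]
    rfl
  have e3 : inner ℂ a (((F x)† ∘L F y) b) = inner ℂ (F x a) (F y b) := by
    rw [ContinuousLinearMap.comp_apply, ContinuousLinearMap.adjoint_inner_right]
  rw [ContinuousLinearMap.adjoint_adjoint, ContinuousLinearMap.adjoint_adjoint, add_apply,
    inner_add_right, e1, e2, e3]
  linear_combination h1

/-- If the adjoint systems of the contractions `Q` and `W` are coupled to the system `f`, then `f`
is the feedback connection of their transfer functions. -/
theorem exists_schurAgler_feedback_of_contraction {X L R A B U Y : Type*} {Ψ : TestFunctions X}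
    [NormedAddCommGroup L] [InnerProductSpace ℂ L] [CompleteSpace L]
    [NormedAddCommGroup R] [InnerProductSpace ℂ R] [CompleteSpace R]
    [NormedAddCommGroup A] [InnerProductSpace ℂ A] [CompleteSpace A]
    [NormedAddCommGroup B] [InnerProductSpace ℂ B] [CompleteSpace B]
    [NormedAddCommGroup U] [InnerProductSpace ℂ U] [CompleteSpace U]
    [NormedAddCommGroup Y] [InnerProductSpace ℂ Y] [CompleteSpace Y]
    {Q : HSum L (HSum A Y) →L[ℂ] HSum L (HSum B U)} (hQ : ‖Q‖ ≤ 1)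
    (hQ' : ∀ l a, ‖(Q (WithLp.toLp 2 (l, WithLp.toLp 2 (a, 0)))).snd.fst‖ ≤ ‖l‖)
    {T : X → (L →L[ℂ] L)} (hT : ∀ x, ‖T x‖ < 1)
    {G : X → (HSum B U →L[ℂ] HSum A Y)} (hG : ∀ x, G x = adjointTransfer Q (T x)) {μ : Ψ.Cb →⋆ₐ[ℂ] (R →L[ℂ] R)}
    {W : HSum R B →L[ℂ] HSum R A} (hW : ‖W‖ ≤ 1) {f : X → (U →L[ℂ] Y)}
    (h : ∀ x y, ∃ (a : A) (b : B) (ρ : R) (l : L),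
      W (WithLp.toLp 2 (((μ (Ψ.E x))†) ρ, b)) = WithLp.toLp 2 (ρ, a) ∧
      Q (WithLp.toLp 2 (((T x)†) l, WithLp.toLp 2 (a, y))) =
        WithLp.toLp 2 (l, WithLp.toLp 2 (b, ((f x)†) y))) :
    ∃ t ∈ SchurAglerClass Ψ A B, ∀ x,
      IsUnit (1 - t x ∘L block11 (G x)) ∧
      f x = block22 (G x) + block21 (G x) ∘L
        Ring.inverse (1 - t x ∘L block11 (G x)) ∘L t x ∘L block12 (G x) := by
  -- The parameter is the transfer function of `W`. The signal `b` closes the loop: it is the output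
  -- of `Q` and the input of `W`.
  refine ⟨_, adjointTransfer_mem_schurAglerClass μ W hW, fun x => ?_⟩
  rw [hG x]
  have hμ := norm_map_E_lt_one μ x
  have hunit : IsUnit (1 - adjointTransfer W (μ (Ψ.E x)) ∘L block11 (adjointTransfer Q (T x))) :=
    isUnit_one_sub_comp _ _ (norm_adjointTransfer_le_one hW hμ)
      ((norm_block11_adjointTransfer_le hQ hQ' (hT x)).trans_lt (hT x))
  refine ⟨hunit, eq_feedback _ _ _ hunit fun y => ?_⟩
  obtain ⟨a, b, ρ, l, h1, h2⟩ := h x y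
  refine ⟨b, ?_⟩
  rw [adjoint_adjointTransfer_eq (isUnit_one_sub_comp_adjoint_block11 W _ hW hμ) h1]
  exact adjoint_adjointTransfer_eq (isUnit_one_sub_comp_adjoint_block11 Q _ hQ (hT x)) h2

/-! ### The unitary extension -/

section Extension

variable {L U Y : Type*} [NormedAddCommGroup L] [InnerProductSpace ℂ L]
  [NormedAddCommGroup U] [InnerProductSpace ℂ U] [NormedAddCommGroup Y] [InnerProductSpace ℂ Y]
  {N₂ : Submodule ℂ (HSum L Y)} {N₁ : Submodule ℂ (HSum L U)} [N₂.HasOrthogonalProjection]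
  (V : N₂ ≃ₗᵢ[ℂ] N₁)

theorem swapExtension_apply (l : L) (m : N₁ᗮ) (y : Y) {l' : L} {u : U}
    (h : (V (N₂.orthogonalProjectionOnto (WithLp.toLp 2 (l, y))) : HSum L U) + m =
      WithLp.toLp 2 (l', u)) :
    swapExtension V (WithLp.toLp 2 (l, WithLp.toLp 2 (m, y))) =
      WithLp.toLp 2 (l', WithLp.toLp 2
        (N₂ᗮ.orthogonalProjectionOnto (WithLp.toLp 2 (l, y)), u)) := by
  have h1 : l' = ((V (N₂.orthogonalProjectionOnto (WithLp.toLp 2 (l, y))) : HSum L U) + m).fst := by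
    rw [h]
    rfl
  have h2 : u = ((V (N₂.orthogonalProjectionOnto (WithLp.toLp 2 (l, y))) : HSum L U) + m).snd := by
    rw [h]
    rfl
  rw [h1, h2]
  rfl

/-- The components in `N₂`, `N₂ᗮ` and `N₁ᗮ` are carried isometrically to orthogonal components, so
Pythagoras on both sides gives the bound. -/
theorem norm_swapExtension_le_one : ‖swapExtension V‖ ≤ 1 := by
  refine ContinuousLinearMap.opNorm_le_bound _ zero_le_one fun v => ?_
  obtain ⟨l, m, y⟩ := v
  set ξ : HSum L Y := WithLp.toLp 2 (l, y)
  set n := V (N₂.orthogonalProjectionOnto ξ)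
  have h1 : ‖(n : HSum L U) + m‖ ^ 2 = ‖n‖ ^ 2 + ‖m‖ ^ 2 := by
    rw [sq, sq, sq]
    exact norm_add_sq_eq_norm_sq_add_norm_sq_of_inner_eq_zero _ _
      (N₁.inner_right_of_mem_orthogonal n.2 m.2)
  have h2 := N₂.norm_sq_eq_add_norm_sq_projection ξ
  have h3 : ‖n‖ = ‖N₂.orthogonalProjectionOnto ξ‖ := V.norm_map _
  have h4 := swapExtension_apply V l m y (l' := ((n : HSum L U) + m).fst)
    (u := ((n : HSum L U) + m).snd) rfl
  have h5 : ‖((n : HSum L U) + m).fst‖ ^ 2 + ‖((n : HSum L U) + m).snd‖ ^ 2 =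
      ‖(n : HSum L U) + m‖ ^ 2 := (norm_sq_toLp _ _).symm
  have h6 : ‖ξ‖ ^ 2 = ‖l‖ ^ 2 + ‖y‖ ^ 2 := norm_sq_toLp _ _
  rw [one_mul]
  refine (sq_le_sq₀ (norm_nonneg _) (norm_nonneg _)).1 ?_
  change ‖swapExtension V (WithLp.toLp 2 (l, WithLp.toLp 2 (m, y)))‖ ^ 2 ≤
    ‖(WithLp.toLp 2 (l, WithLp.toLp 2 (m, y)) : HSum L (HSum N₁ᗮ Y))‖ ^ 2
  rw [h4]
  simp only [norm_sq_toLp]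
  rw [h3] at h1
  linarith

/-- The swap puts `a` only into the output `L ⊕ U`, so the `N₂ᗮ` component is just the projection of
`l ⊕ 0`. -/
theorem norm_snd_fst_swapExtension_le (l : L) (a : N₁ᗮ) :
    ‖(swapExtension V (WithLp.toLp 2 (l, WithLp.toLp 2 (a, 0)))).snd.fst‖ ≤ ‖l‖ := by
  have h1 : (swapExtension V (WithLp.toLp 2 (l, WithLp.toLp 2 (a, 0)))).snd.fst =
    N₂ᗮ.orthogonalProjectionOnto (WithLp.toLp 2 (l, 0)) := rfl
  rw [h1]
  refine (Submodule.norm_orthogonalProjectionOnto_apply_le _ _).trans_eq ?_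
  refine (sq_eq_sq₀ (norm_nonneg _) (norm_nonneg _)).1 ?_
  rw [norm_sq_toLp]
  simp

end Extension

/-! ### Contractions with prescribed values -/

theorem closedSpan_ext {ι H K : Type*} [NormedAddCommGroup H] [InnerProductSpace ℂ H]
    [NormedAddCommGroup K] [NormedSpace ℂ K] {a : ι → H} {S T : closedSpan a →L[ℂ] K}
    (h : ∀ i, S ⟨a i, mem_closedSpan a i⟩ = T ⟨a i, mem_closedSpan a i⟩) : S = T := by
  have hc : ∀ i, combination a (Finsupp.single i 1) = ⟨a i, mem_closedSpan a i⟩ := by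
    intro i
    ext
    simp [combination]
  have : S.toLinearMap ∘ₗ combination a = T.toLinearMap ∘ₗ combination a := by
    refine Finsupp.lhom_ext' fun i => LinearMap.ext_ring ?_
    simpa [hc] using h i
  exact ContinuousLinearMap.coeFn_injective ((denseRange_combination a).equalizer S.continuous
    T.continuous (funext fun c => LinearMap.congr_fun this c))

/-- The Gram unitary between the closed spans, extended by zero on the orthogonal complement. A
partial isometry suffices, because only contractivity is needed for the transfer function. -/
theorem exists_contraction_of_gram {ι H K : Type*} [NormedAddCommGroup H] [InnerProductSpace ℂ H]
    [CompleteSpace H] [NormedAddCommGroup K] [InnerProductSpace ℂ K] [CompleteSpace K]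
    (a : ι → H) (b : ι → K) (h : ∀ i j, inner ℂ (a i) (a j) = inner ℂ (b i) (b j)) :
    ∃ W : H →L[ℂ] K, ‖W‖ ≤ 1 ∧ ∀ i, W (a i) = b i := by
  refine ⟨(closedSpan b).subtypeL ∘L
    (gramUnitary a b h).toContinuousLinearEquiv.toContinuousLinearMap ∘L
      (closedSpan a).orthogonalProjectionOnto, ?_, fun i => ?_⟩
  · refine ContinuousLinearMap.opNorm_le_bound _ zero_le_one fun x => ?_
    rw [one_mul]
    change ‖gramUnitary a b h ((closedSpan a).orthogonalProjectionOnto x)‖ ≤ ‖x‖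
    rw [LinearIsometryEquiv.norm_map]
    exact Submodule.norm_orthogonalProjectionOnto_apply_le _ x
  · change ((gramUnitary a b h ((closedSpan a).orthogonalProjectionOnto (a i)) : closedSpan b) : K)
      = b i
    have h1 : (closedSpan a).orthogonalProjectionOnto (a i) = ⟨a i, mem_closedSpan a i⟩ :=
      Submodule.orthogonalProjectionOnto_mem_subspace_eq_self (⟨a i, mem_closedSpan a i⟩ :
        closedSpan a)
    rw [h1, gramUnitary_apply]

/-- Given a family of pairs `(ζ p ⊕ y p, η p ⊕ u p)` with equal Gram matrices in `R ⊕ Y` and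
`R ⊕ U` that extends the unitary `V` on a subspace of `L ⊕ Y`, where `L` embeds into `R` through
the isometry `J`, the passage `ζ p ⊕ y p ↦ η p ⊕ u p` is the feedback connection of the unitary
extension of `V` with a contraction. -/
theorem exists_contraction_feedback {ι L R U Y : Type*}
    [NormedAddCommGroup L] [InnerProductSpace ℂ L] [CompleteSpace L]
    [NormedAddCommGroup R] [InnerProductSpace ℂ R] [CompleteSpace R]
    [NormedAddCommGroup U] [InnerProductSpace ℂ U] [CompleteSpace U]
    [NormedAddCommGroup Y] [InnerProductSpace ℂ Y] [CompleteSpace Y]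
    {N₂ : Submodule ℂ (HSum L Y)} {N₁ : Submodule ℂ (HSum L U)} [CompleteSpace N₂]
    [CompleteSpace N₁] (V : N₂ ≃ₗᵢ[ℂ] N₁) (J : L →L[ℂ] R)
    (hJ : ∀ l, (J†) (J l) = l) (ζ η : ι → R) (y : ι → Y) (u : ι → U)
    (hgram : ∀ p q, inner ℂ (ζ p) (ζ q) + inner ℂ (y p) (y q) =
      inner ℂ (η p) (η q) + inner ℂ (u p) (u q))
    (hV : ∀ p (g : N₂), inner ℂ (WithLp.toLp 2 ((J†) (ζ p), y p)) (g : HSum L Y) =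
      inner ℂ (WithLp.toLp 2 ((J†) (η p), u p)) (V g : HSum L U)) :
    ∃ W : HSum R N₂ᗮ →L[ℂ] HSum R N₁ᗮ, ‖W‖ ≤ 1 ∧ ∀ p, ∃ (m₁ : N₁ᗮ) (m₂ : N₂ᗮ),
      W (WithLp.toLp 2 (ζ p - J ((J†) (ζ p)), m₂)) = WithLp.toLp 2 (η p - J ((J†) (η p)), m₁) ∧
      swapExtension V (WithLp.toLp 2 ((J†) (ζ p), WithLp.toLp 2 (m₁, y p))) =
        WithLp.toLp 2 ((J†) (η p), WithLp.toLp 2 (m₂, u p)) := by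
  let ξ₂ : ι → HSum L Y := fun p => WithLp.toLp 2 ((J†) (ζ p), y p)
  let ξ₁ : ι → HSum L U := fun p => WithLp.toLp 2 ((J†) (η p), u p)
  let n₂ : ι → N₂ := fun p => N₂.orthogonalProjectionOnto (ξ₂ p)
  let n₁ : ι → N₁ := fun p => N₁.orthogonalProjectionOnto (ξ₁ p)
  let m₂ : ι → N₂ᗮ := fun p => N₂ᗮ.orthogonalProjectionOnto (ξ₂ p)
  let m₁ : ι → N₁ᗮ := fun p => N₁ᗮ.orthogonalProjectionOnto (ξ₁ p)
  have hξ₂ : ∀ p, ξ₂ p = (n₂ p : HSum L Y) + m₂ p := fun p =>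
    (N₂.starProjection_add_starProjection_orthogonal (ξ₂ p)).symm
  have hξ₁ : ∀ p, ξ₁ p = (n₁ p : HSum L U) + m₁ p := fun p =>
    (N₁.starProjection_add_starProjection_orthogonal (ξ₁ p)).symm
  -- Since `V` is onto, it is enough to pair with vectors `V g`; the components orthogonal to `N₂`
  -- and `N₁` drop out and `hV` remains.
  have hVn : ∀ p, V (n₂ p) = n₁ p := by
    intro p
    refine ext_inner_right ℂ fun g => ?_
    obtain ⟨g, rfl⟩ := V.surjective g
    rw [V.inner_map_map]
    have h1 : inner ℂ (n₂ p) g = inner ℂ (ξ₂ p) (g : HSum L Y) := by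
      rw [hξ₂, inner_add_left, Submodule.inner_left_of_mem_orthogonal g.2 (m₂ p).2, add_zero]
      rfl
    have h2 : inner ℂ (n₁ p) (V g) = inner ℂ (ξ₁ p) (V g : HSum L U) := by
      rw [hξ₁, inner_add_left, Submodule.inner_left_of_mem_orthogonal (V g).2 (m₁ p).2, add_zero]
      rfl
    rw [h1, h2]
    exact hV p g
  have hi₂ : ∀ p q, inner ℂ (ξ₂ p) (ξ₂ q) = inner ℂ (n₂ p) (n₂ q) + inner ℂ (m₂ p) (m₂ q) := by
    intro p q
    rw [hξ₂, hξ₂, inner_add_left, inner_add_right, inner_add_right,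
      Submodule.inner_right_of_mem_orthogonal (n₂ p).2 (m₂ q).2,
      Submodule.inner_left_of_mem_orthogonal (n₂ q).2 (m₂ p).2, add_zero, zero_add]
    rfl
  have hi₁ : ∀ p q, inner ℂ (ξ₁ p) (ξ₁ q) = inner ℂ (n₁ p) (n₁ q) + inner ℂ (m₁ p) (m₁ q) := by
    intro p q
    rw [hξ₁, hξ₁, inner_add_left, inner_add_right, inner_add_right,
      Submodule.inner_right_of_mem_orthogonal (n₁ p).2 (m₁ q).2,
      Submodule.inner_left_of_mem_orthogonal (n₁ q).2 (m₁ p).2, add_zero, zero_add]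
    rfl
  have hn : ∀ p q, inner ℂ (n₁ p) (n₁ q) = inner ℂ (n₂ p) (n₂ q) := by
    intro p q
    rw [← hVn, ← hVn, V.inner_map_map]
  -- As `J` is isometric, `J J†` is the orthogonal projection onto its range; this is the polarized
  -- Pythagoras identity.
  have hp : ∀ a b : R, inner ℂ (a - J ((J†) a)) (b - J ((J†) b)) =
      inner ℂ a b - inner ℂ ((J†) a) ((J†) b) := by
    intro a b
    have e1 : ∀ (c : L) (d : R), inner ℂ (J c) d = inner ℂ c ((J†) d) := fun c d =>
      (ContinuousLinearMap.adjoint_inner_right J c d).symm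
    have e2 : ∀ (c : R) (d : L), inner ℂ c (J d) = inner ℂ ((J†) c) d := fun c d =>
      (ContinuousLinearMap.adjoint_inner_left J d c).symm
    rw [inner_sub_left, inner_sub_right, inner_sub_right, e1, e1, e2, hJ]
    ring
  obtain ⟨W, hW1, hW2⟩ := exists_contraction_of_gram
    (fun p => (WithLp.toLp 2 (ζ p - J ((J†) (ζ p)), m₂ p) : HSum R N₂ᗮ))
    (fun p => (WithLp.toLp 2 (η p - J ((J†) (η p)), m₁ p) : HSum R N₁ᗮ)) (by
      intro p q
      have h1 := hi₁ p q
      have h2 := hi₂ p q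
      rw [inner_toLp] at h1 h2
      rw [inner_toLp, inner_toLp, hp, hp]
      linear_combination hgram p q + h1 - h2 + hn p q)
  refine ⟨W, hW1, fun p => ⟨m₁ p, m₂ p, hW2 p, ?_⟩⟩
  refine swapExtension_apply V _ _ _ ?_
  change (V (n₂ p) : HSum L U) + m₁ p = ξ₁ p
  rw [hVn, hξ₁]

/-! ### The auxiliary function -/

section Data

variable {X : Type*} {Ψ : TestFunctions X} {ι U Y : Type*}
  [NormedAddCommGroup U] [InnerProductSpace ℂ U] [CompleteSpace U]
  [NormedAddCommGroup Y] [InnerProductSpace ℂ Y] [CompleteSpace Y]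
  {X₁ : Type*} [NormedAddCommGroup X₁] [InnerProductSpace ℂ X₁] [CompleteSpace X₁]

section Restriction

variable (z : ι → X) (μ : Ψ.Cb →⋆ₐ[ℂ] (X₁ →L[ℂ] X₁)) (h : Set.range z → (X₁ →L[ℂ] Y))

/-- The restriction of `μ` to `L₁`, as a `*`-representation. -/
noncomputable def repHom : Ψ.Cb →⋆ₐ[ℂ] (L₁ z μ h →L[ℂ] L₁ z μ h) where
  toFun := rep z μ h
  map_one' := ContinuousLinearMap.ext fun x => Subtype.ext <| by simp [rep]
  map_mul' a b := ContinuousLinearMap.ext fun x => Subtype.ext <| by simp [rep]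
  map_zero' := ContinuousLinearMap.ext fun x => Subtype.ext <| by simp [rep]
  map_add' a b := ContinuousLinearMap.ext fun x => Subtype.ext <| by simp [rep]
  commutes' c := ContinuousLinearMap.ext fun x => Subtype.ext <| by
    simp [rep, Algebra.algebraMap_eq_smul_one]
  map_star' a := by
    rw [ContinuousLinearMap.star_eq_adjoint, ContinuousLinearMap.eq_adjoint_iff]
    intro x y
    change inner ℂ (μ (star a) (x : X₁)) (y : X₁) = inner ℂ (x : X₁) (μ a (y : X₁))
    rw [map_star, ContinuousLinearMap.star_eq_adjoint, ContinuousLinearMap.adjoint_inner_left]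

variable {z μ h}

theorem inner_comp_map_star_mul {T L Y : Type*} [TopologicalSpace T] [NormedAddCommGroup L]
    [InnerProductSpace ℂ L] [CompleteSpace L] [NormedAddCommGroup Y] [InnerProductSpace ℂ Y]
    [CompleteSpace Y] (μ : (T →ᵇ ℂ) →⋆ₐ[ℂ] (L →L[ℂ] L)) (g g' : L →L[ℂ] Y) (δ δ' : T →ᵇ ℂ)
    (v w : Y) : inner ℂ v ((g ∘L μ (star δ * δ') ∘L g'†) w) =
      inner ℂ (μ δ ((g†) v)) (μ δ' ((g'†) w)) := by
  rw [map_mul, map_star, ContinuousLinearMap.star_eq_adjoint,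
    ← ContinuousLinearMap.adjoint_inner_right, ContinuousLinearMap.comp_apply,
    ← ContinuousLinearMap.adjoint_inner_left]
  rfl

/-- A second Kolmogorov decomposition contains a copy of the minimal part of the first one. -/
theorem exists_intertwining_isometry {X₂ : Type*} [NormedAddCommGroup X₂] [InnerProductSpace ℂ X₂]
    [CompleteSpace X₂] {Γ : Set.range z → Set.range z → (Ψ.Cb →L[ℂ] (Y →L[ℂ] Y))}
    (hK : IsKolmogorov Γ μ h) (μ₂ : Ψ.Cb →⋆ₐ[ℂ] (X₂ →L[ℂ] X₂)) (h₂ : X → (X₂ →L[ℂ] Y))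
    (hK₂ : IsKolmogorov Γ μ₂ fun p => h₂ p) :
    ∃ J : L₁ z μ h →L[ℂ] X₂, (∀ l, (J†) (J l) = l) ∧
      (∀ δ l, J (rep z μ h δ l) = μ₂ δ (J l)) ∧
      ∀ i y, J (hvec z μ h i y) = ((h₂ (z i))†) y := by
  let a : Ψ.Cb × ι × Y → X₁ := fun p => μ p.1 (((h (node z p.2.1))†) p.2.2)
  let b : Ψ.Cb × ι × Y → X₂ := fun p => μ₂ p.1 (((h₂ (z p.2.1))†) p.2.2)
  -- Both Gram matrices are read off from `Γ` at `δ^* δ'`, so they do not depend on the chosen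
  -- decomposition.
  have hgram : ∀ p q, inner ℂ (a p) (a q) = inner ℂ (b p) (b q) := by
    rintro ⟨δ, i, y⟩ ⟨δ', j, w⟩
    have e := congrArg (fun T : Y →L[ℂ] Y => inner ℂ y (T w))
      ((hK (node z i) (node z j) (star δ * δ')).symm.trans
        (hK₂ (node z i) (node z j) (star δ * δ')))
    exact (inner_comp_map_star_mul μ _ _ _ _ _ _).symm.trans
      (e.trans (inner_comp_map_star_mul μ₂ _ _ _ _ _ _))
  let J : L₁ z μ h →L[ℂ] X₂ := (closedSpan b).subtypeL ∘L
    (gramUnitary a b hgram).toContinuousLinearEquiv.toContinuousLinearMap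
  have hJ : ∀ p, J ⟨a p, mem_closedSpan a p⟩ = b p := fun p =>
    congrArg Subtype.val (gramUnitary_apply a b hgram p)
  refine ⟨J, fun l => ?_, fun δ l => ?_, fun i y => ?_⟩
  · refine ext_inner_right ℂ fun l' => ?_
    rw [ContinuousLinearMap.adjoint_inner_left]
    exact (gramUnitary a b hgram).inner_map_map l l'
  · have : J ∘L rep z μ h δ = μ₂ δ ∘L J := by
      refine closedSpan_ext (a := a) fun p => ?_
      have h1 : rep z μ h δ ⟨a p, mem_closedSpan a p⟩ =
          ⟨a (δ * p.1, p.2), mem_closedSpan a (δ * p.1, p.2)⟩ := by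
        refine Subtype.ext ?_
        change μ δ (a p) = _
        simp [a]
      change J (rep z μ h δ ⟨a p, mem_closedSpan a p⟩) = μ₂ δ (J ⟨a p, mem_closedSpan a p⟩)
      rw [h1, hJ, hJ]
      simp [b]
    exact congrArg (fun T : L₁ z μ h →L[ℂ] X₂ => T l) this
  · have h1 : hvec z μ h i y = ⟨a (1, i, y), mem_closedSpan a (1, i, y)⟩ := by
      refine Subtype.ext ?_
      change ((h (node z i))†) y = _
      simp [a]
    rw [h1, hJ]
    simp [b]

end Restriction

variable {z : ι → X} {B : ι → (U →L[ℂ] Y)} {μ : Ψ.Cb →⋆ₐ[ℂ] (X₁ →L[ℂ] X₁)}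
  {h : Set.range z → (X₁ →L[ℂ] Y)} {Γ : Set.range z → Set.range z → (Ψ.Cb →L[ℂ] (Y →L[ℂ] Y))}
  (hΓ : DecomposesData z B Γ) (hK : IsKolmogorov Γ μ h)

theorem norm_Q_le_one : ‖Q hΓ hK‖ ≤ 1 := 
  norm_swapExtension_le_one (N₂ := N₂ z μ h) (N₁ := N₁ z B μ h) (V hΓ hK)

theorem G_mem_schurAglerClass :
    G hΓ hK ∈ SchurAglerClass Ψ (HSum (M₂ z μ h) U) (HSum (M₁ z B μ h) Y) :=
  adjointTransfer_mem_schurAglerClass (L := L₁ z μ h) (A := HSum (M₁ z B μ h) Y)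
    (B := HSum (M₂ z μ h) U) (repHom z μ h) (Q hΓ hK) (norm_Q_le_one hΓ hK)

theorem norm_rep_E_lt_one (x : X) : ‖rep z μ h (Ψ.E x)‖ < 1 := norm_map_E_lt_one (repHom z μ h) x

theorem norm_snd_fst_Q_le (l : L₁ z μ h) (a : M₁ z B μ h) :
    ‖(Q hΓ hK (WithLp.toLp 2 (l, WithLp.toLp 2 (a, 0)))).snd.fst‖ ≤ ‖l‖ :=
  norm_snd_fst_swapExtension_le (N₂ := N₂ z μ h) (N₁ := N₁ z B μ h) (V hΓ hK) l a

theorem norm_block11_G_lt_one (x : X) : ‖block11 (G hΓ hK x)‖ < 1 :=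
  (norm_block11_adjointTransfer_le (L := L₁ z μ h) (A := M₁ z B μ h)
    (B := M₂ z μ h) (U := U) (Y := Y) (Q := Q hΓ hK) (norm_Q_le_one hΓ hK)
    (norm_snd_fst_Q_le hΓ hK) (norm_rep_E_lt_one x)).trans_lt (norm_rep_E_lt_one x)

/-! ### The lurking isometry of `f` and its coupling with `Q` -/

/-- The lurking isometry of an Agler decomposition. -/
theorem inner_add_inner_of_decomposition {X₂ : Type*} [NormedAddCommGroup X₂]
    [InnerProductSpace ℂ X₂] [CompleteSpace X₂] {μ₂ : Ψ.Cb →⋆ₐ[ℂ] (X₂ →L[ℂ] X₂)}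
    {h₂ : X → (X₂ →L[ℂ] Y)} {f : X → (U →L[ℂ] Y)}
    (hf : ∀ x y, 1 - f x ∘L (f y)† = h₂ x ∘L μ₂ (1 - Ψ.E x * star (Ψ.E y)) ∘L (h₂ y)†)
    (x y : X) (v w : Y) :
    inner ℂ (((μ₂ (Ψ.E x))†) (((h₂ x)†) v)) (((μ₂ (Ψ.E y))†) (((h₂ y)†) w)) + inner ℂ v w =
      inner ℂ (((h₂ x)†) v) (((h₂ y)†) w) + inner ℂ (((f x)†) v) (((f y)†) w) := by
  have e := congrArg (fun T : Y →L[ℂ] Y => inner ℂ v (T w)) (hf x y)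
  have e1 : inner ℂ v ((1 - f x ∘L (f y)†) w) =
      inner ℂ v w - inner ℂ (((f x)†) v) (((f y)†) w) := by
    rw [ContinuousLinearMap.adjoint_inner_left, ← inner_sub_right]
    rfl
  have e2 : inner ℂ v ((h₂ x ∘L μ₂ (1 - Ψ.E x * star (Ψ.E y)) ∘L (h₂ y)†) w) =
      inner ℂ (((h₂ x)†) v) (((h₂ y)†) w) -
        inner ℂ (((μ₂ (Ψ.E x))†) (((h₂ x)†) v)) (((μ₂ (Ψ.E y))†) (((h₂ y)†) w)) := by
    rw [ContinuousLinearMap.adjoint_inner_left, ContinuousLinearMap.adjoint_inner_left,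
      ContinuousLinearMap.adjoint_inner_left, ← inner_sub_right, ← map_sub, map_sub, map_one,
      map_mul, map_star]
    rfl
  simp only [e1, e2] at e
  linear_combination e

theorem adjoint_rep (x : X) : (rep z μ h (Ψ.E x))† = rep z μ h (star (Ψ.E x)) :=
  (map_star (repHom z μ h) (Ψ.E x)).symm

/-- Moving `J†` across as `J` turns the generators of `N₂` and `N₁` into the corresponding vectors
at the node `z i`. What remains is the lurking isometry identity for the points `x` and `z i`. -/
theorem inner_vec_of_intertwining {X₂ : Type*} [NormedAddCommGroup X₂]
    [InnerProductSpace ℂ X₂] [CompleteSpace X₂] {μ₂ : Ψ.Cb →⋆ₐ[ℂ] (X₂ →L[ℂ] X₂)}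
    {h₂ : X → (X₂ →L[ℂ] Y)} {f : X → (U →L[ℂ] Y)}
    (hf : ∀ x y, 1 - f x ∘L (f y)† = h₂ x ∘L μ₂ (1 - Ψ.E x * star (Ψ.E y)) ∘L (h₂ y)†)
    (hfB : ∀ i, f (z i) = B i) (J : L₁ z μ h →L[ℂ] X₂)
    (hJμ : ∀ δ l, J (rep z μ h δ l) = μ₂ δ (J l))
    (hJh : ∀ i y, J (hvec z μ h i y) = ((h₂ (z i))†) y) (x : X) (y : Y) (p : ι × Y) :
    inner ℂ (WithLp.toLp 2 ((J†) (((μ₂ (Ψ.E x))†) (((h₂ x)†) y)), y)) (vec₂ z μ h p) =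
      inner ℂ (WithLp.toLp 2 ((J†) (((h₂ x)†) y), ((f x)†) y)) (vec₁ z B μ h p) := by
  obtain ⟨i, w⟩ := p
  rw [vec₁, vec₂, inner_toLp, inner_toLp, adjoint_rep, ContinuousLinearMap.adjoint_inner_left J,
    ContinuousLinearMap.adjoint_inner_left J, hJμ, hJh, ← hfB, map_star μ₂,
    ContinuousLinearMap.star_eq_adjoint]
  exact inner_add_inner_of_decomposition hf x (z i) y w

/-- A function with an Agler decomposition that extends the one of the data is the feedback
connection of the unitary `Q` with a contraction. -/
theorem exists_contraction_state {X₂ : Type*} [NormedAddCommGroup X₂]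
    [InnerProductSpace ℂ X₂] [CompleteSpace X₂] {μ₂ : Ψ.Cb →⋆ₐ[ℂ] (X₂ →L[ℂ] X₂)}
    {h₂ : X → (X₂ →L[ℂ] Y)} {f : X → (U →L[ℂ] Y)} (hK₂ : IsKolmogorov Γ μ₂ fun p => h₂ p)
    (hf : ∀ x y, 1 - f x ∘L (f y)† = h₂ x ∘L μ₂ (1 - Ψ.E x * star (Ψ.E y)) ∘L (h₂ y)†)
    (hfB : ∀ i, f (z i) = B i) :
    ∃ W : HSum X₂ (M₂ z μ h) →L[ℂ] HSum X₂ (M₁ z B μ h), ‖W‖ ≤ 1 ∧ ∀ x y,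
      ∃ (m₁ : M₁ z B μ h) (m₂ : M₂ z μ h) (ρ : X₂) (l : L₁ z μ h),
        W (WithLp.toLp 2 (((μ₂ (Ψ.E x))†) ρ, m₂)) = WithLp.toLp 2 (ρ, m₁) ∧
        Q hΓ hK (WithLp.toLp 2 (((rep z μ h (Ψ.E x))†) l, WithLp.toLp 2 (m₁, y))) =
          WithLp.toLp 2 (l, WithLp.toLp 2 (m₂, ((f x)†) y)) := by
  obtain ⟨J, hJ, hJμ, hJh⟩ := exists_intertwining_isometry hK μ₂ h₂ hK₂
  let η : X × Y → X₂ := fun p => ((h₂ p.1)†) p.2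
  let ζ : X × Y → X₂ := fun p => ((μ₂ (Ψ.E p.1))†) (η p)
  have hJζ : ∀ x (a : X₂), (J†) (((μ₂ (Ψ.E x))†) a) = ((rep z μ h (Ψ.E x))†) ((J†) a) := by
    intro x a
    refine ext_inner_right ℂ fun l => ?_
    rw [ContinuousLinearMap.adjoint_inner_left J, ContinuousLinearMap.adjoint_inner_left,
      ContinuousLinearMap.adjoint_inner_left, ContinuousLinearMap.adjoint_inner_left J, hJμ]
  obtain ⟨W, hW1, hW2⟩ := exists_contraction_feedback (L := L₁ z μ h) (R := X₂) (U := U)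
    (Y := Y) (N₂ := N₂ z μ h) (N₁ := N₁ z B μ h) (V hΓ hK) J hJ ζ η (fun p => p.2)
    (fun p => ((f p.1)†) p.2)
    (fun p q => inner_add_inner_of_decomposition hf p.1 q.1 p.2 q.2) (by
      rintro ⟨x, y⟩ g
      -- Both sides are continuous linear functionals of `g`, so agreement on the generators of `N₂`
      -- is enough.
      have : innerSL ℂ (WithLp.toLp 2 ((J†) (ζ (x, y)), y) : HSum (L₁ z μ h) Y) ∘L
          (N₂ z μ h).subtypeL = innerSL ℂ (WithLp.toLp 2 ((J†) (η (x, y)), ((f x)†) y)) ∘L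
          (N₁ z B μ h).subtypeL ∘L (V hΓ hK).toContinuousLinearEquiv.toContinuousLinearMap := by
        refine closedSpan_ext (a := vec₂ z μ h) fun p => ?_
        have h1 : V hΓ hK ⟨vec₂ z μ h p, mem_closedSpan _ _⟩ =
            ⟨vec₁ z B μ h p, mem_closedSpan _ _⟩ := gramUnitary_apply _ _ _ _
        change inner ℂ (WithLp.toLp 2 ((J†) (ζ (x, y)), y)) (vec₂ z μ h p) =
          inner ℂ (WithLp.toLp 2 ((J†) (η (x, y)), ((f x)†) y))
            (V hΓ hK ⟨vec₂ z μ h p, mem_closedSpan _ _⟩ : HSum (L₁ z μ h) U)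
        rw [h1]
        exact inner_vec_of_intertwining hf hfB J hJμ hJh x y p
      exact congrArg (fun T : N₂ z μ h →L[ℂ] ℂ => T g) this)
  refine ⟨W, hW1, fun x y => ?_⟩
  obtain ⟨m₁, m₂, h1, h2⟩ := hW2 (x, y)
  -- The state `η` is shared out: its part in `J L₁` drives `Q` and its orthogonal part drives `W`.
  -- Each part evolves on its own because `J L₁` reduces `μ₂`.
  refine ⟨m₁, m₂, η (x, y) - J ((J†) (η (x, y))), (J†) (η (x, y)), ?_, ?_⟩
  · rw [← h1, map_sub, ← ContinuousLinearMap.star_eq_adjoint (μ₂ (Ψ.E x)), ← map_star μ₂, ← hJμ,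
      ← adjoint_rep, ← hJζ, map_star μ₂, ContinuousLinearMap.star_eq_adjoint]
  · rw [← hJζ]
    exact h2

set_option maxRecDepth 10000 in
set_option maxHeartbeats 4000000 in
/-- A function with an Agler decomposition that extends the one of the data is the feedback
connection of the auxiliary function with a function of the Schur-Agler class. -/
theorem exists_schurAgler_feedback {X₂ : Type*} [NormedAddCommGroup X₂]
    [InnerProductSpace ℂ X₂] [CompleteSpace X₂] {μ₂ : Ψ.Cb →⋆ₐ[ℂ] (X₂ →L[ℂ] X₂)}
    {h₂ : X → (X₂ →L[ℂ] Y)} {f : X → (U →L[ℂ] Y)} (hK₂ : IsKolmogorov Γ μ₂ fun p => h₂ p)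
    (hf : ∀ x y, 1 - f x ∘L (f y)† = h₂ x ∘L μ₂ (1 - Ψ.E x * star (Ψ.E y)) ∘L (h₂ y)†)
    (hfB : ∀ i, f (z i) = B i) :
    ∃ t ∈ SchurAglerClass Ψ (M₁ z B μ h) (M₂ z μ h), ∀ x : X,
      IsUnit (1 - t x ∘L block11 (G hΓ hK x)) ∧
      f x = block22 (G hΓ hK x) + block21 (G hΓ hK x) ∘L
        Ring.inverse (1 - t x ∘L block11 (G hΓ hK x)) ∘L t x ∘L block12 (G hΓ hK x) := by
  obtain ⟨W, hW1, hW2⟩ := exists_contraction_state hΓ hK hK₂ hf hfB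
  exact exists_schurAgler_feedback_of_contraction (L := L₁ z μ h) (R := X₂) (A := M₁ z B μ h)
    (B := M₂ z μ h) (U := U) (Y := Y) (Q := Q hΓ hK) (norm_Q_le_one hΓ hK)
    (norm_snd_fst_Q_le hΓ hK) (T := fun x => rep z μ h (Ψ.E x)) norm_rep_E_lt_one
    (G := G hΓ hK) (fun _ => rfl) hW1 hW2

end Data

end SchurAgler

theorem theorem5p1 {m : ℕ} {Ω : Set (EuclideanSpace ℂ (Fin m))}
    (hΩ_open : IsOpen Ω) (hΩ_conn : IsConnected Ω)
    (Ψ : TestFunctions Ω) (hΨ : Ψ.IsHolomorphic)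
    {U : Type u} [NormedAddCommGroup U] [InnerProductSpace ℂ U] [CompleteSpace U]
    {Y : Type v} [NormedAddCommGroup Y] [InnerProductSpace ℂ Y] [CompleteSpace Y]
    {n : ℕ} (z : Fin n → Ω) (B : Fin n → (U →L[ℂ] Y))
    (Γ : Set.range z → Set.range z → (Ψ.Cb →L[ℂ] (Y →L[ℂ] Y)))
    (hΓ_cp : IsCompletelyPositive Γ) (hΓ : DecomposesData z B Γ)
    (f : Ω → (U →L[ℂ] Y)) (hf : f ∈ SchurAglerClass Ψ U Y) (hfB : ∀ i, f (z i) = B i)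
    (hfΓ : IsAffiliated z Γ f) :
    (∃ (X₁ : Type v) (_ : NormedAddCommGroup X₁) (_ : InnerProductSpace ℂ X₁)
      (_ : CompleteSpace X₁) (μ : Ψ.Cb →⋆ₐ[ℂ] (X₁ →L[ℂ] X₁)) (h : Set.range z → (X₁ →L[ℂ] Y)),
      IsKolmogorov Γ μ h) ∧
    ∀ (X₁ : Type w) [NormedAddCommGroup X₁] [InnerProductSpace ℂ X₁] [CompleteSpace X₁]
      (μ : Ψ.Cb →⋆ₐ[ℂ] (X₁ →L[ℂ] X₁)) (h : Set.range z → (X₁ →L[ℂ] Y))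
      (hK : IsKolmogorov Γ μ h),
      G hΓ hK ∈ SchurAglerClass Ψ (HSum (M₂ z μ h) U) (HSum (M₁ z B μ h) Y) ∧
      (∀ x, ‖block11 (G hΓ hK x)‖ < 1) ∧
      ∃ t ∈ SchurAglerClass Ψ (M₁ z B μ h) (M₂ z μ h), ∀ x : Ω,
        IsUnit (1 - t x ∘L block11 (G hΓ hK x)) ∧
        f x = block22 (G hΓ hK x) + block21 (G hΓ hK x) ∘L
          Ring.inverse (1 - t x ∘L block11 (G hΓ hK x)) ∘L t x ∘L block12 (G hΓ hK x) := by
  refine ⟨hΓ_cp.exists_isKolmogorov, fun X₁ _ _ _ μ h hK =>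
    ⟨G_mem_schurAglerClass hΓ hK, norm_block11_G_lt_one hΓ hK, ?_⟩⟩
  obtain ⟨Δ, hΔ_cp, hfΔ, hΓΔ⟩ := hfΓ
  -- A decomposition of `Δ` on all of `Ω` restricts on the nodes to one of `Γ`, which is where
  -- affiliation enters.
  obtain ⟨X₂, _, _, _, μ₂, h₂, hK₂⟩ := hΔ_cp.exists_isKolmogorov
  refine exists_schurAgler_feedback hΓ hK (μ₂ := μ₂) (h₂ := h₂) ?_ ?_ hfB
  · rintro ⟨_, i, rfl⟩ ⟨_, j, rfl⟩ δ
    exact (congrArg (fun S => S δ) (hΓΔ i j)).trans (hK₂ _ _ δ)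
  · exact fun x y => (hfΔ x y).trans (hK₂ x y _)
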